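/- Let $L,T>0$, $\overline U_0>0$, $\lambda>0$ with $\overline U_0<\lambda^{-1}$, and $H=L^2(0,L)\times L^2(0,L)$. For $\varepsilon\in(0,\varepsilon_0)$ let $(u^\varepsilon,\psi^\varepsilon)\in\mathcal K$ solve, on $(0,L)\times(0,T)$, $$u^\varepsilon_t+\overline U_0u^\varepsilon_x+\psi^\varepsilon_x-2\varepsilon u^\varepsilon_{xx}=f,\qquad \psi^\varepsilon_t+\overline U_0\psi^\varepsilon_x+\lambda^{-2}u^\varepsilon_x=g,$$ $$u^\varepsilon(0,t)=u^\varepsilon(L,t)=0,\quad \psi^\varepsilon(0,t)=0,\quad u^\varepsilon(x,0)=u_0(x),\quad \psi^\varepsilon(x,0)=\psi_0(x),$$ and let $(u^0,\psi^0)\in\mathcal K^0$ solve, with the same data $f,g,u_0,\psi_0$ (independent of $\varepsilon$), $$u^0_t+\overline U_0u^0_x+\psi^0_x=f,\qquad \psi^0_t+\overline U_0\psi^0_x+\lambda^{-2}u^0_x=g,$$ $$u^0(0,t)+\overline U_0\lambda^2\psi^0(0,t)=0,\quad u^0(L,t)=0,\quad u^0(x,0)=u_0(x),\quad \psi^0(x,0)=\psi_0(x).$$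 Here $$D(A)=\{(u,\psi)\in H: u_x,\psi_x,u_{xx}\in L^2(0,L),\ u(0)=\psi(0)=u(L)=0\},$$ $$D(A^0)=\{(u,\psi)\in H: u_x,\psi_x\in L^2(0,L),\ u(0)+\overline U_0\lambda^2\psi(0)=0,\ u(L)=0\};$$ $\mathcal K$ is the set of $(u,\psi)\in C([0,T];H)\cap L^\infty(0,T;D(A))$ with $\psi_{xt},\psi_{xx}\in L^\infty(0,T;L^2(0,L))$ and $(u_t,\psi_t)\in C([0,T];H)$; and $\mathcal K^0$ is the set of $(u,\psi)\in C([0,T];H)\cap L^\infty(0,T;D(A^0))$ with $\psi_{xt},u_{xx},\psi_{xx}\in L^\infty(0,T;L^2(0,L))$ and $(u_t,\psi_t)\in C([0,T];H)$. All derivatives are weak derivatives. Then: 1. For every nonnegative function $\delta(\varepsilon)$ with $\delta(\varepsilon)\to0$ and $\delta(\varepsilon)/\varepsilon\to+\infty$ as $\varepsilon\to0^+$, $$\lim_{\varepsilon\to0^+}\|(u^\varepsilon-u^0,\psi^\varepsilon-\psi^0)\|_{L^\infty(0,T;L^\infty(\delta(\varepsilon),L))}=0.$$ 2. If $(u^0(0,t),\psi^0(0,t))$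 is not identically $(0,0)$ in $(0,T)$ (that is, it is not $(0,0)$ for almost every $t\in(0,T)$), then for every nonnegative function $\delta(\varepsilon)$ that is positive for all sufficiently small $\varepsilon>0$ and satisfies $\delta(\varepsilon)\to0$ and $\delta(\varepsilon)/\varepsilon\to c$ as $\varepsilon\to0^+$ for some constant $c\ge0$, $$\liminf_{\varepsilon\to0^+}\|(u^\varepsilon-u^0,\psi^\varepsilon-\psi^0)\|_{L^\infty(0,T;L^\infty(0,\delta(\varepsilon)))}>0.$$ In the sense of 1 and 2, the thickness of the boundary layer at $x=0$ is of order $\varepsilon$. -/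

import Mathlib

open MeasureTheory Set Filter Topology
open scoped ENNReal ContDiff

noncomputable section

namespace OceanBL

/-- The Lebesgue space `L²(0, L)`. -/
abbrev L2 (L : ℝ) : Type := Lp ℝ 2 (volume.restrict (Ioo (0 : ℝ) L))

/-- `w` is the weak (distributional) derivative of `v` on the open interval `(a, b)`, for functions
with values in a real normed space: both are locally integrable on `(a, b)` and
`∫ φ' v = - ∫ φ w` for every real test function `φ ∈ C_c^∞(a, b)`. -/
def HasWeakDeriv {E : Type*} [NormedAddCommGroup E] [NormedSpace ℝ E] (a b : ℝ)
    (v w : ℝ → E) : Prop :=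
  LocallyIntegrableOn v (Ioo a b) ∧ LocallyIntegrableOn w (Ioo a b) ∧
    ∀ φ : ℝ → ℝ, ContDiff ℝ ∞ φ → HasCompactSupport φ → tsupport φ ⊆ Ioo a b →
      ∫ s in Ioo a b, deriv φ s • v s = -∫ s in Ioo a b, φ s • w s

/-- `v ∈ L²(0, L)` has a representative that is continuous on `[0, L]` and takes the value `c`
at the point `a` (for `v ∈ H¹(0, L)` and `a ∈ {0, L}` this says that the trace of `v` at `a`
is `c`). -/
def HasValueAt {L : ℝ} (v : L2 L) (a c : ℝ) : Prop :=
  ∃ r : ℝ → ℝ, ContinuousOn r (Icc 0 L) ∧ (v : ℝ → ℝ) =ᵐ[volume.restrict (Ioo 0 L)] r ∧ r a = c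

/-- Spatial derivative of a path in `L²(0, L)`: `v_x(t) = vx(t)` weakly on `(0, L)`, for almost
every `t ∈ (0, T)`. -/
def IsDx (T : ℝ) {L : ℝ} (v vx : ℝ → L2 L) : Prop :=
  ∀ᵐ t ∂(volume.restrict (Ioo 0 T)), HasWeakDeriv 0 L (v t : ℝ → ℝ) (vx t : ℝ → ℝ)

/-- Time derivative of a path in `L²(0, L)`: `v_t = vt` in the sense of `L²(0, L)`-valued
distributions on `(0, T)`. -/
def IsDt (T : ℝ) {L : ℝ} (v vt : ℝ → L2 L) : Prop :=
  HasWeakDeriv 0 T v vt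

/-- `v ∈ C([0, T]; L²(0, L))`. -/
def MemC (T : ℝ) {L : ℝ} (v : ℝ → L2 L) : Prop :=
  ContinuousOn v (Icc 0 T)

/-- `v ∈ L^∞(0, T; L²(0, L))` (strongly measurable and essentially bounded). -/
def MemLinf (T : ℝ) {L : ℝ} (v : ℝ → L2 L) : Prop :=
  MemLp v ∞ (volume.restrict (Ioo 0 T))

/-- `(u, ψ) ∈ L^∞(0, T; D(A))`, where `D(A)` is the space of all `(u, ψ) ∈ L² × L²` with
`u_x, ψ_x, u_xx ∈ L²(0, L)` and `u(0) = ψ(0) = u(L) = 0`, normed by the `L²` norms of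
`u, ψ, u_x, ψ_x, u_xx`. -/
def MemLinfDA (T : ℝ) {L : ℝ} (u ψ : ℝ → L2 L) : Prop :=
  MemLinf T u ∧ MemLinf T ψ ∧
  (∃ ux uxx ψx : ℝ → L2 L, IsDx T u ux ∧ IsDx T ux uxx ∧ IsDx T ψ ψx ∧
    MemLinf T ux ∧ MemLinf T uxx ∧ MemLinf T ψx) ∧
  ∀ᵐ t ∂(volume.restrict (Ioo 0 T)),
    HasValueAt (u t) 0 0 ∧ HasValueAt (ψ t) 0 0 ∧ HasValueAt (u t) L 0

/-- `(u, ψ) ∈ L^∞(0, T; D(A⁰))`, where `D(A⁰)` is the space of all `(u, ψ) ∈ L² × L²` with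
`u_x, ψ_x ∈ L²(0, L)`, `u(0) + U₀ λ² ψ(0) = 0` and `u(L) = 0`, normed by the `L²` norms of
`u, ψ, u_x, ψ_x`. -/
def MemLinfDA0 (U₀ lam T : ℝ) {L : ℝ} (u ψ : ℝ → L2 L) : Prop :=
  MemLinf T u ∧ MemLinf T ψ ∧
  (∃ ux ψx : ℝ → L2 L, IsDx T u ux ∧ IsDx T ψ ψx ∧ MemLinf T ux ∧ MemLinf T ψx) ∧
  ∀ᵐ t ∂(volume.restrict (Ioo 0 T)),
    (∃ a b : ℝ, HasValueAt (u t) 0 a ∧ HasValueAt (ψ t) 0 b ∧ a + U₀ * lam ^ 2 * b = 0) ∧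
      HasValueAt (u t) L 0

/-- The regularity class `𝒦`: `(u, ψ) ∈ C([0, T]; H) ∩ L^∞(0, T; D(A))` with
`ψ_xt, ψ_xx ∈ L^∞(0, T; L²)` and `(u_t, ψ_t) ∈ C([0, T]; H)`, where `H = L² × L²`. -/
def MemK (T : ℝ) {L : ℝ} (u ψ : ℝ → L2 L) : Prop :=
  MemC T u ∧ MemC T ψ ∧ MemLinfDA T u ψ ∧
  (∃ ψx ψxt ψxx : ℝ → L2 L, IsDx T ψ ψx ∧ IsDt T ψx ψxt ∧ IsDx T ψx ψxx ∧
    MemLinf T ψxt ∧ MemLinf T ψxx) ∧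
  ∃ ut ψt : ℝ → L2 L, IsDt T u ut ∧ IsDt T ψ ψt ∧ MemC T ut ∧ MemC T ψt

/-- The regularity class `𝒦⁰`: `(u, ψ) ∈ C([0, T]; H) ∩ L^∞(0, T; D(A⁰))` with
`ψ_xt, u_xx, ψ_xx ∈ L^∞(0, T; L²)` and `(u_t, ψ_t) ∈ C([0, T]; H)`. -/
def MemK0 (U₀ lam T : ℝ) {L : ℝ} (u ψ : ℝ → L2 L) : Prop :=
  MemC T u ∧ MemC T ψ ∧ MemLinfDA0 U₀ lam T u ψ ∧
  (∃ ux uxx : ℝ → L2 L, IsDx T u ux ∧ IsDx T ux uxx ∧ MemLinf T uxx) ∧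
  (∃ ψx ψxt ψxx : ℝ → L2 L, IsDx T ψ ψx ∧ IsDt T ψx ψxt ∧ IsDx T ψx ψxx ∧
    MemLinf T ψxt ∧ MemLinf T ψxx) ∧
  ∃ ut ψt : ℝ → L2 L, IsDt T u ut ∧ IsDt T ψ ψt ∧ MemC T ut ∧ MemC T ψt

/-- `(u, ψ)` solves the viscous problem: the equations
`u_t + U₀ u_x + ψ_x - 2 ε u_xx = f` and `ψ_t + U₀ ψ_x + λ⁻² u_x = g` hold almost everywhere,
`u(0, t) = u(L, t) = 0` and `ψ(0, t) = 0` for almost every `t`, and `u(·, 0) = u₀`,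
`ψ(·, 0) = ψ₀`. -/
def SolvesViscous (U₀ lam T ε : ℝ) {L : ℝ} (f g : ℝ → L2 L) (u₀ ψ₀ : L2 L)
    (u ψ : ℝ → L2 L) : Prop :=
  (∃ ut ψt ux ψx uxx : ℝ → L2 L,
    IsDt T u ut ∧ IsDt T ψ ψt ∧ IsDx T u ux ∧ IsDx T ψ ψx ∧ IsDx T ux uxx ∧
    ∀ᵐ t ∂(volume.restrict (Ioo 0 T)),
      ut t + U₀ • ux t + ψx t - (2 * ε) • uxx t = f t ∧
      ψt t + U₀ • ψx t + (lam⁻¹ ^ 2) • ux t = g t) ∧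
  (∀ᵐ t ∂(volume.restrict (Ioo 0 T)),
    HasValueAt (u t) 0 0 ∧ HasValueAt (u t) L 0 ∧ HasValueAt (ψ t) 0 0) ∧
  u 0 = u₀ ∧ ψ 0 = ψ₀

/-- `(u, ψ)` solves the limit problem: the equations `u_t + U₀ u_x + ψ_x = f` and
`ψ_t + U₀ ψ_x + λ⁻² u_x = g` hold almost everywhere, `u(0, t) + U₀ λ² ψ(0, t) = 0` and
`u(L, t) = 0` for almost every `t`, and `u(·, 0) = u₀`, `ψ(·, 0) = ψ₀`. -/
def SolvesLimit (U₀ lam T : ℝ) {L : ℝ} (f g : ℝ → L2 L) (u₀ ψ₀ : L2 L)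
    (u ψ : ℝ → L2 L) : Prop :=
  (∃ ut ψt ux ψx : ℝ → L2 L,
    IsDt T u ut ∧ IsDt T ψ ψt ∧ IsDx T u ux ∧ IsDx T ψ ψx ∧
    ∀ᵐ t ∂(volume.restrict (Ioo 0 T)),
      ut t + U₀ • ux t + ψx t = f t ∧
      ψt t + U₀ • ψx t + (lam⁻¹ ^ 2) • ux t = g t) ∧
  (∀ᵐ t ∂(volume.restrict (Ioo 0 T)),
    (∃ a b : ℝ, HasValueAt (u t) 0 a ∧ HasValueAt (ψ t) 0 b ∧ a + U₀ * lam ^ 2 * b = 0) ∧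
      HasValueAt (u t) L 0) ∧
  u 0 = u₀ ∧ ψ 0 = ψ₀

/-- The extended norm `‖(v, w)‖` in `L^∞(0, T; L^∞(a, b))`, for `(a, b) ⊆ (0, L)` (in general the
interval `(a, b) ∩ (0, L)` is used): the essential supremum over `t ∈ (0, T)` and `x ∈ (a, b)` of
`max (|v(x, t)|, |w(x, t)|)`. -/
def linfNorm (T a b : ℝ) {L : ℝ} (v w : ℝ → L2 L) : ℝ≥0∞ :=
  essSup (fun t => eLpNorm (fun x => ((v t : ℝ → ℝ) x, (w t : ℝ → ℝ) x)) ∞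
    ((volume.restrict (Ioo 0 L)).restrict (Ioo a b))) (volume.restrict (Ioo 0 T))

/-- `(v(0, t), w(0, t))` vanishes identically in `(0, T)`. -/
def VanishesAtLeft (T : ℝ) {L : ℝ} (v w : ℝ → L2 L) : Prop :=
  ∀ᵐ t ∂(volume.restrict (Ioo 0 T)), HasValueAt (v t) 0 0 ∧ HasValueAt (w t) 0 0

end OceanBL

end

/-!
Write `l = λ²` and `b(t) = ψ⁰(0, t)`, so that `u⁰(0, t) = -U₀ l b(t)`, whereas both components of
the viscous solution vanish at `x = 0`.

*Inside the layer.* The component `ψ^ε - ψ⁰` has a continuous representative with the value `-b(t)`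
at `x = 0`, so its supremum over `(0, δ)` is at least `|b(t)|` for every `δ > 0`. If the boundary
values of the limit do not vanish identically, `|b| ≥ m` for some `m > 0` on a set of times of
positive measure, and `m` is a lower bound for the norm (`le_linfNorm`).

*Outside the layer.* The stationary viscous equations have the solution `(A k, -k)`, `A = U₀ l`,
`k = exp (-α x / ε)`, where `2 A α = 1 - A U₀` is positive because `U₀ < λ⁻¹`. Cutting `k` off by
the factor `1 - x / L` gives a corrector `b (A k, -k)`, and the remainder
`(r, s) = (u^ε - u⁰ - b A k, ψ^ε - ψ⁰ + b k)` vanishes at `x = 0`, at `t = 0`, and `r` also at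
`x = L`. It solves the viscous system with a forcing that consists of a term of size `ε` and of
terms of boundary layer type, of size `O(1)` on a layer of width `ε` (`IsErrorSystem`).

The equation for `s` has no viscosity, and its forcing `b' k` is not small enough for the plain
energy method. Transport at speed `U₀ > 0` carries `s` out of the layer, and the weight
`1 + K exp (-α x / ε)` in the energy of `s` turns this into the damping
`(K² / 2ε) ∫ exp (-α x / ε) s²` (`energy_dissipation`), from which `‖r‖, ‖s‖ = O(ε)` in `L²`,
uniformly in time, and `∫ ‖r_x‖² = O(ε)` (`IsErrorSystem.energy`).

For the derivatives, test the equation for `r` with `-r_xx`, and eliminate `r_xx` between it and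
the `x`-derivative of the equation for `s`: the combination `σ = s_x + r / (2 l ε)` solves a
transport equation with speed `U₀` and damping `1 / (2 l ε)`, and its value at `x = 0` is controlled
by the trace of `r_x`. Therefore `‖r_x‖², ‖s_x‖² = O(1 / ε)`
(`deriv_dissipation`, `IsErrorSystem.deriv_bound`). Interpolation between the two estimates gives
`|r|², |s|² = O(ε^{1/2})` uniformly, so that the error is `O(ε^{1/4}) + O(exp (-α x / ε))`
(`exists_layer_bound`), and `exp (-α δ / ε) → 0` if `δ / ε → ∞`.

As paths in `L²`, `s_x` is merely Lipschitz and `r_xx` merely essentially bounded in time. The energy identities are replaced by the one-sided inequality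
`IsPath.inner_le_integral`, which uses difference quotients and the monotonicity of the operator
that defines the energy. Functions in `H¹(0, L)` are written as `c + ∫₀ˣ w`, with the integration
operator `J` on `L²(0, L)`.
-/

noncomputable section

namespace OceanBL

open scoped RealInnerProductSpace

/-! ### Primitives and traces on `(0, L)` -/

section Spatial

variable {L : ℝ}

theorem intervalIntegrable_coe (hL : 0 ≤ L) (w : L2 L) : IntervalIntegrable w volume 0 L := by
  rw [intervalIntegrable_iff_integrableOn_Ioo_of_le hL]
  have := integrableOn_Lp_of_measure_ne_top (s := univ) w (by norm_num) (by simp)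
  simpa [IntegrableOn] using this

theorem intervalIntegrable_coe_of_mem (w : L2 L) {x : ℝ} (hx : x ∈ Icc 0 L) :
    IntervalIntegrable w volume 0 x :=
  (intervalIntegrable_coe (hx.1.trans hx.2) w).mono_set
    (by rw [uIcc_of_le hx.1, uIcc_of_le (hx.1.trans hx.2)]; exact Icc_subset_Icc_right hx.2)

theorem inner_eq_intervalIntegral (hL : 0 ≤ L) (v w : L2 L) :
    ⟪v, w⟫ = ∫ x in (0 : ℝ)..L, v x * w x := by
  rw [L2.inner_def, intervalIntegral.integral_of_le hL, integral_Ioc_eq_integral_Ioo]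
  refine integral_congr_ae (Eventually.of_forall fun x => ?_)
  simp [mul_comm]

theorem intervalIntegrable_mul_coe (hL : 0 ≤ L) (v w : L2 L) :
    IntervalIntegrable (fun x => v x * w x) volume 0 L := by
  rw [intervalIntegrable_iff_integrableOn_Ioo_of_le hL]
  refine (L2.integrable_inner (𝕜 := ℝ) v w).congr (Eventually.of_forall fun x => ?_)
  simp [mul_comm]

/-- The absolutely continuous representative `c + ∫₀ˣ w` of the function in `H¹(0, L)` with
derivative `w` and value `c` at `0`. -/
def prim (c : ℝ) (w : L2 L) (x : ℝ) : ℝ := c + ∫ y in (0 : ℝ)..x, w y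

@[simp] theorem prim_zero (c : ℝ) (w : L2 L) : prim c w 0 = c := by simp [prim]

theorem prim_absolutelyContinuous (hL : 0 ≤ L) (c : ℝ) (w : L2 L) :
    AbsolutelyContinuousOnInterval (prim c w) 0 L := by
  have h1 := (intervalIntegrable_coe hL w).absolutelyContinuousOnInterval_intervalIntegral
    (c := 0) (by simp)
  have h2 : AbsolutelyContinuousOnInterval (fun _ : ℝ => c) 0 L :=
    (contDiff_const.contDiffOn (n := 1)).absolutelyContinuousOnInterval
  exact h2.add h1

theorem prim_continuousOn (hL : 0 ≤ L) (c : ℝ) (w : L2 L) :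
    ContinuousOn (prim c w) (Icc 0 L) := by
  simpa [uIcc_of_le hL] using (prim_absolutelyContinuous hL c w).continuousOn

theorem ae_hasDerivAt_prim (hL : 0 ≤ L) (c : ℝ) (w : L2 L) :
    ∀ᵐ x, x ∈ uIcc 0 L → HasDerivAt (prim c w) (w x) x := by
  filter_upwards [(intervalIntegrable_coe hL w).ae_hasDerivAt_integral] with x hx hx'
  exact (hx hx' 0 (by simp)).const_add c

theorem abs_integral_le_norm (w : L2 L) {x : ℝ} (hx : x ∈ Icc 0 L) :
    |∫ y in (0 : ℝ)..x, w y| ≤ L ^ (1 / (2 : ℝ)) * ‖w‖ := by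
  have h : ∫ y in (0 : ℝ)..x, w y
      = ⟪(indicatorConstLp 2 (μ := volume.restrict (Ioo (0 : ℝ) L))
        (measurableSet_Ioo (a := (0 : ℝ)) (b := x)) (measure_ne_top _ _) (1 : ℝ)), w⟫ := by
    rw [L2.inner_indicatorConstLp_one, intervalIntegral.integral_of_le hx.1,
      integral_Ioc_eq_integral_Ioo, Measure.restrict_restrict measurableSet_Ioo,
      inter_eq_left.2 (Ioo_subset_Ioo_right hx.2)]
  rw [h]
  refine (abs_real_inner_le_norm _ _).trans ?_
  gcongr
  refine norm_indicatorConstLp_le.trans ?_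
  rw [measureReal_restrict_apply measurableSet_Ioo,
      inter_eq_left.2 (Ioo_subset_Ioo_right hx.2), Real.volume_real_Ioo_of_le hx.1]
  simp only [norm_one, one_mul, sub_zero, ENNReal.toReal_ofNat]
  exact Real.rpow_le_rpow hx.1 hx.2 (by norm_num)

theorem memLp_of_continuousOn {k : ℝ → ℝ} (hk : ContinuousOn k (Icc 0 L)) :
    MemLp k 2 (volume.restrict (Ioo 0 L)) := by
  obtain ⟨C, hC⟩ := isCompact_Icc.exists_bound_of_continuousOn hk
  refine MemLp.of_bound ((hk.mono Ioo_subset_Icc_self).aestronglyMeasurable measurableSet_Ioo) C ?_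
  filter_upwards [ae_restrict_mem measurableSet_Ioo] with x hx
  exact hC x (Ioo_subset_Icc_self hx)

theorem memLp_prim (hL : 0 ≤ L) (c : ℝ) (w : L2 L) :
    MemLp (prim c w) 2 (volume.restrict (Ioo 0 L)) :=
  memLp_of_continuousOn (prim_continuousOn hL c w)

/-- The element of `L²(0, L)` given by a function `k`, with the junk value `0` if `k` is not square
integrable on `(0, L)`. -/
def toL2 (L : ℝ) (k : ℝ → ℝ) : L2 L :=
  open Classical in
  if h : MemLp k 2 (volume.restrict (Ioo 0 L)) then h.toLp k else 0

theorem coeFn_toL2 {k : ℝ → ℝ} (h : MemLp k 2 (volume.restrict (Ioo 0 L))) :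
    toL2 L k =ᵐ[volume.restrict (Ioo 0 L)] k := by
  rw [toL2, dif_pos h]; exact h.coeFn_toLp

theorem prim_add (c d : ℝ) (v w : L2 L) {x : ℝ} (hx : x ∈ Icc 0 L) :
    prim (c + d) (v + w) x = prim c v x + prim d w x := by
  have : ∫ y in (0 : ℝ)..x, (v + w : L2 L) y = ∫ y in (0 : ℝ)..x, (v y + w y) := by
    rw [intervalIntegral.integral_of_le hx.1, intervalIntegral.integral_of_le hx.1,
      integral_Ioc_eq_integral_Ioo, integral_Ioc_eq_integral_Ioo]
    exact integral_congr_ae (ae_restrict_of_ae_restrict_of_subset (Ioo_subset_Ioo_right hx.2)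
      (Lp.coeFn_add v w))
  rw [prim, prim, prim, this, intervalIntegral.integral_add (intervalIntegrable_coe_of_mem v hx)
    (intervalIntegrable_coe_of_mem w hx)]
  ring

theorem prim_smul (a c : ℝ) (w : L2 L) {x : ℝ} (hx : x ∈ Icc 0 L) :
    prim (a * c) (a • w) x = a * prim c w x := by
  have : ∫ y in (0 : ℝ)..x, (a • w : L2 L) y = ∫ y in (0 : ℝ)..x, a * w y := by
    rw [intervalIntegral.integral_of_le hx.1, intervalIntegral.integral_of_le hx.1,
      integral_Ioc_eq_integral_Ioo, integral_Ioc_eq_integral_Ioo]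
    exact integral_congr_ae (ae_restrict_of_ae_restrict_of_subset (Ioo_subset_Ioo_right hx.2)
      (Lp.coeFn_smul a w))
  rw [prim, prim, this, intervalIntegral.integral_const_mul]
  ring

/-- The integration operator `w ↦ ∫₀ˣ w` on `L²(0, L)`. -/
def J (hL : 0 ≤ L) : L2 L →L[ℝ] L2 L :=
  LinearMap.mkContinuous
    { toFun := fun w => toL2 L (prim 0 w)
      map_add' := fun v w => by
        apply Lp.ext
        filter_upwards [coeFn_toL2 (memLp_prim hL 0 (v + w)), coeFn_toL2 (memLp_prim hL 0 v),
          coeFn_toL2 (memLp_prim hL 0 w), ae_restrict_mem measurableSet_Ioo,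
          Lp.coeFn_add (toL2 L (prim 0 v)) (toL2 L (prim 0 w))] with x h1 h2 h3 h4 h5
        rw [h1, h5, Pi.add_apply, h2, h3]
        simpa using prim_add 0 0 v w (Ioo_subset_Icc_self h4)
      map_smul' := fun a w => by
        apply Lp.ext
        filter_upwards [coeFn_toL2 (memLp_prim hL 0 (a • w)), coeFn_toL2 (memLp_prim hL 0 w),
          ae_restrict_mem measurableSet_Ioo,
          Lp.coeFn_smul a (toL2 L (prim 0 w))] with x h1 h2 h4 h5
        simp only [RingHom.id_apply]
        rw [h1, h5, Pi.smul_apply, h2]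
        simpa using prim_smul a 0 w (Ioo_subset_Icc_self h4) }
    ((measureUnivNNReal (volume.restrict (Ioo (0 : ℝ) L)) : ℝ) ^ (2 : ℝ≥0∞).toReal⁻¹
      * L ^ (1 / (2 : ℝ)))
    (fun w => by
      rw [mul_assoc]
      refine Lp.norm_le_of_ae_bound (by positivity) ?_
      filter_upwards [coeFn_toL2 (memLp_prim hL 0 w), ae_restrict_mem measurableSet_Ioo]
        with x h1 h2
      simp only [LinearMap.coe_mk, AddHom.coe_mk]
      rw [h1, prim, zero_add]
      exact abs_integral_le_norm w (Ioo_subset_Icc_self h2))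

theorem coeFn_J (hL : 0 ≤ L) (w : L2 L) :
    J hL w =ᵐ[volume.restrict (Ioo 0 L)] prim 0 w :=
  coeFn_toL2 (memLp_prim hL 0 w)

/-- The constant function `1` in `L²(0, L)`. Every `v ∈ H¹(0, L)` is `c • one L + J w` with its
value `c` at `0` and its derivative `w`, and `⟪one L, w⟫ = v(L) - v(0)`. -/
def one (L : ℝ) : L2 L := toL2 L fun _ => 1

theorem coeFn_one : one L =ᵐ[volume.restrict (Ioo 0 L)] fun _ => 1 :=
  coeFn_toL2 (memLp_of_continuousOn continuousOn_const)

theorem coeFn_smul_one_add_J (hL : 0 ≤ L) (c : ℝ) (w : L2 L) :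
    (c • one L + J hL w : L2 L) =ᵐ[volume.restrict (Ioo 0 L)] prim c w := by
  filter_upwards [Lp.coeFn_add (c • one L) (J hL w), Lp.coeFn_smul c (one L), coeFn_one,
    coeFn_J hL w] with x h1 h2 h3 h4
  rw [h1, Pi.add_apply, h2, Pi.smul_apply, h3, h4]
  simp [prim]

theorem ae_Ioo_iff_ae_uIoc (hL : 0 ≤ L) {p : ℝ → Prop} :
    (∀ᵐ x ∂(volume.restrict (Ioo 0 L)), p x) ↔ ∀ᵐ x, x ∈ uIoc 0 L → p x := by
  rw [uIoc_of_le hL, ← ae_restrict_iff' measurableSet_Ioc, Measure.restrict_congr_set Ioo_ae_eq_Ioc]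

theorem inner_one (hL : 0 ≤ L) (w : L2 L) : ⟪one L, w⟫ = ∫ x in (0 : ℝ)..L, w x := by
  rw [inner_eq_intervalIntegral hL]
  refine intervalIntegral.integral_congr_ae ((ae_Ioo_iff_ae_uIoc hL).1 ?_)
  filter_upwards [coeFn_one] with x hx
  rw [hx, one_mul]

theorem inner_one_one (hL : 0 ≤ L) : ⟪one L, one L⟫ = L := by
  rw [inner_one hL]
  rw [intervalIntegral.integral_congr_ae ((ae_Ioo_iff_ae_uIoc hL).1 (coeFn_one))]
  simp

theorem prim_right (hL : 0 ≤ L) (c : ℝ) (w : L2 L) : prim c w L = c + ⟪one L, w⟫ := by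
  rw [inner_one hL, prim]

/-- The representation of a function in `H¹(0, L)` by its value at `0` and its derivative is
unique. -/
theorem eq_zero_of_smul_one_add_J_eq_zero (hL : 0 < L) {c : ℝ} {w : L2 L}
    (h : c • one L + J hL.le w = 0) : c = 0 ∧ w = 0 := by
  have h0 : ∀ᵐ x ∂(volume.restrict (Ioo 0 L)), prim c w x = 0 := by
    filter_upwards [coeFn_smul_one_add_J hL.le c w, Lp.coeFn_zero ℝ 2 (volume.restrict (Ioo 0 L))]
      with x h1 h2
    rw [← h1, h, h2]; rfl
  have h1 : EqOn (prim c w) 0 (Icc 0 L) := by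
    refine Measure.eqOn_Icc_of_ae_eq volume hL.ne ?_ (prim_continuousOn hL.le c w)
      continuousOn_const
    rw [Measure.restrict_congr_set Ioo_ae_eq_Icc.symm]
    exact h0
  refine ⟨by simpa using h1 (left_mem_Icc.2 hL.le), ?_⟩
  apply Lp.ext
  have h2 := (ae_restrict_iff' (measurableSet_Ioo (a := 0) (b := L))).2
    ((ae_hasDerivAt_prim hL.le c w).mono
      fun x hx hx' => hx (by rw [uIcc_of_le hL.le]; exact Ioo_subset_Icc_self hx'))
  filter_upwards [h2, ae_restrict_mem measurableSet_Ioo,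
    Lp.coeFn_zero ℝ 2 (volume.restrict (Ioo 0 L))] with x h2 h3 h4
  rw [h4, Pi.zero_apply]
  have h5 : HasDerivAt (prim c w) 0 x := by
    refine (hasDerivAt_const x (0 : ℝ)).congr_of_eventuallyEq ?_
    filter_upwards [Ioo_mem_nhds h3.1 h3.2] with y hy
    exact h1 (Ioo_subset_Icc_self hy)
  exact h2.unique h5

/-- Fundamental theorem of calculus for `θ v²` with `v ∈ H¹(0, L)` and a smooth weight `θ`. -/
theorem integral_weight_sq (c : ℝ) (w : L2 L) {θ θ' : ℝ → ℝ}
    (hθ : ∀ x, HasDerivAt θ (θ' x) x) (hθ' : Continuous θ') {x : ℝ} (hx : x ∈ Icc 0 L) :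
    ∫ y in (0 : ℝ)..x, (θ' y * prim c w y ^ 2 + 2 * (θ y * (prim c w y * w y)))
      = θ x * prim c w x ^ 2 - θ 0 * c ^ 2 := by
  have hL : 0 ≤ L := hx.1.trans hx.2
  have hsub : uIcc 0 x ⊆ uIcc 0 L := by
    rw [uIcc_of_le hx.1, uIcc_of_le hL]; exact Icc_subset_Icc_right hx.2
  have hθ1 : ContDiff ℝ 1 θ := by
    rw [contDiff_one_iff_deriv]
    refine ⟨fun y => (hθ y).differentiableAt, ?_⟩
    rwa [show deriv θ = θ' from funext fun y => (hθ y).deriv]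
  have hac1 : AbsolutelyContinuousOnInterval θ 0 L :=
    hθ1.contDiffOn.absolutelyContinuousOnInterval
  have hac2 := prim_absolutelyContinuous hL c w
  have hac := (hac1.mul (hac2.mul hac2)).mono hsub
  have key := hac.integral_deriv_eq_sub
  simp only [Pi.mul_apply, prim_zero] at key
  rw [pow_two, pow_two, ← key]
  refine intervalIntegral.integral_congr_ae ?_
  filter_upwards [ae_hasDerivAt_prim hL c w] with y hy hy'
  have h1 := hy (hsub (uIoc_subset_uIcc hy'))
  have h2 := ((hθ y).mul (h1.mul h1)).deriv
  rw [h2]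
  simp only [Pi.mul_apply]
  ring

/-- Integration by parts in `H¹(0, L)`. -/
theorem inner_smul_one_add_J (hL : 0 ≤ L) (c d : ℝ) (v w : L2 L) :
    ⟪c • one L + J hL v, w⟫ + ⟪v, d • one L + J hL w⟫
      = (c + ⟪one L, v⟫) * (d + ⟪one L, w⟫) - c * d := by
  have h := (prim_absolutelyContinuous hL c v).integral_deriv_mul_eq_sub
    (prim_absolutelyContinuous hL d w)
  rw [prim_right hL, prim_right hL, prim_zero, prim_zero] at h
  rw [← h, inner_eq_intervalIntegral hL, inner_eq_intervalIntegral hL,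
    ← intervalIntegral.integral_add (intervalIntegrable_mul_coe hL _ _)
      (intervalIntegrable_mul_coe hL _ _)]
  refine intervalIntegral.integral_congr_ae ?_
  filter_upwards [ae_hasDerivAt_prim hL c v, ae_hasDerivAt_prim hL d w,
    (ae_Ioo_iff_ae_uIoc hL).1 (coeFn_smul_one_add_J hL c v),
    (ae_Ioo_iff_ae_uIoc hL).1 (coeFn_smul_one_add_J hL d w)] with x h1 h2 h3 h4 hx
  rw [h3 hx, h4 hx, (h1 (uIoc_subset_uIcc hx)).deriv, (h2 (uIoc_subset_uIcc hx)).deriv]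
  ring

theorem abs_integral_mul_le_norm (v : L2 L) {x : ℝ} (hx : x ∈ Icc 0 L) (w : L2 L) :
    |∫ y in (0 : ℝ)..x, v y * w y| ≤ ‖v‖ * ‖w‖ := by
  have hL : 0 ≤ L := hx.1.trans hx.2
  have hi := intervalIntegrable_mul_coe hL v w
  calc |∫ y in (0 : ℝ)..x, v y * w y| ≤ ∫ y in (0 : ℝ)..x, |v y * w y| :=
        intervalIntegral.abs_integral_le_integral_abs hx.1
    _ ≤ ∫ y in (0 : ℝ)..L, |v y * w y| :=
        intervalIntegral.integral_mono_interval le_rfl hx.1 hx.2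
          (Eventually.of_forall fun _ => abs_nonneg _) hi.abs
    _ = ⟪|v|, |w|⟫ := by
        rw [inner_eq_intervalIntegral hL]
        refine intervalIntegral.integral_congr_ae ((ae_Ioo_iff_ae_uIoc hL).1 ?_)
        filter_upwards [Lp.coeFn_abs v, Lp.coeFn_abs w] with y h1 h2
        rw [h1, h2, abs_mul]
    _ ≤ ‖|v|‖ * ‖|w|‖ := real_inner_le_norm _ _
    _ = ‖v‖ * ‖w‖ := by rw [norm_abs_eq_norm, norm_abs_eq_norm]

/-- The interpolation inequality `|v|² ≤ |v(0)|² + 2 ‖v‖ ‖v'‖` in `H¹(0, L)`. -/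
theorem sq_prim_le (c : ℝ) (w : L2 L) {x : ℝ} (hx : x ∈ Icc 0 L) :
    prim c w x ^ 2 ≤ c ^ 2 + 2 * (‖c • one L + J (hx.1.trans hx.2) w‖ * ‖w‖) := by
  have hL : 0 ≤ L := hx.1.trans hx.2
  have h := integral_weight_sq c w (θ := fun _ => 1) (θ' := fun _ => 0)
    (fun x => hasDerivAt_const x 1) continuous_const hx
  have h2 := abs_integral_mul_le_norm (c • one L + J hL w) hx w
  have h3 : ∫ y in (0 : ℝ)..x, (c • one L + J hL w : L2 L) y * w y
      = ∫ y in (0 : ℝ)..x, prim c w y * w y := by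
    refine intervalIntegral.integral_congr_ae ?_
    filter_upwards [(ae_Ioo_iff_ae_uIoc hL).1 (coeFn_smul_one_add_J hL c w)] with y hy hy'
    rw [hy (by rw [uIoc_of_le hx.1] at hy'; rw [uIoc_of_le hL]; exact ⟨hy'.1, hy'.2.trans hx.2⟩)]
  simp only [zero_mul, one_mul, zero_add, intervalIntegral.integral_const_mul] at h
  rw [h3] at h2
  nlinarith [le_abs_self (∫ y in (0 : ℝ)..x, prim c w y * w y)]

/-- The trace inequality `|v(0)|² ≤ L⁻¹ ‖v‖² + 2 ‖v‖ ‖v'‖` in `H¹(0, L)`. -/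
theorem sq_trace_le (hL : 0 < L) (c : ℝ) (w : L2 L) :
    c ^ 2 ≤ L⁻¹ * ‖c • one L + J hL.le w‖ ^ 2 + 2 * (‖c • one L + J hL.le w‖ * ‖w‖) := by
  set v := c • one L + J hL.le w with hv
  have hpt : ∀ᵐ x ∂(volume.restrict (Ioo 0 L)), v x = prim c w x := coeFn_smul_one_add_J hL.le c w
  -- a weight that is `1` at `0` and `0` at `L` isolates the trace at `0`
  have h := integral_weight_sq c w (θ := fun x => 1 - L⁻¹ * x) (θ' := fun _ => -L⁻¹)
    (fun x => by simpa using ((hasDerivAt_id x).const_mul L⁻¹).const_sub 1) continuous_const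
    (right_mem_Icc.2 hL.le)
  have hi1 : IntervalIntegrable (fun x => L⁻¹ * (v x * v x)) volume 0 L :=
    (intervalIntegrable_mul_coe hL.le v v).const_mul _
  have hi2 : IntervalIntegrable (fun x => 2 * (|v| x * |w| x)) volume 0 L :=
    (intervalIntegrable_mul_coe hL.le |v| |w|).const_mul _
  have h1 : -∫ y in (0 : ℝ)..L, (-L⁻¹ * prim c w y ^ 2 + 2 * ((1 - L⁻¹ * y) * (prim c w y * w y)))
      ≤ ∫ y in (0 : ℝ)..L, (L⁻¹ * (v y * v y) + 2 * (|v| y * |w| y)) := by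
    rw [← intervalIntegral.integral_neg]
    refine intervalIntegral.integral_mono_ae_restrict hL.le ?_ (hi1.add hi2) ?_
    · have hc : ContinuousOn (prim c w) (uIcc 0 L) := by
        rw [uIcc_of_le hL.le]; exact prim_continuousOn hL.le c w
      refine (IntervalIntegrable.add ?_ ?_).neg
      · exact (continuousOn_const.mul (hc.pow 2)).intervalIntegrable
      · refine (IntervalIntegrable.continuousOn_mul ?_ (by fun_prop)).const_mul _
        exact (intervalIntegrable_coe hL.le w).continuousOn_mul hc
    · rw [← Measure.restrict_congr_set (Ioo_ae_eq_Icc (a := (0 : ℝ)) (b := L))]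
      filter_upwards [hpt, Lp.coeFn_abs v, Lp.coeFn_abs w, ae_restrict_mem measurableSet_Ioo]
        with y h1 h2 h3 hy
      rw [h2, h3, ← abs_mul, h1]
      have hy1 : 0 ≤ 1 - L⁻¹ * y := by
        rw [sub_nonneg, inv_mul_le_one₀ hL]; exact hy.2.le
      have hy2 : 1 - L⁻¹ * y ≤ 1 := by
        have := mul_nonneg (inv_nonneg.2 hL.le) hy.1.le
        linarith
      have := neg_abs_le (prim c w y * w y)
      nlinarith [abs_nonneg (prim c w y * w y)]
  rw [h, intervalIntegral.integral_add hi1 hi2, intervalIntegral.integral_const_mul,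
    intervalIntegral.integral_const_mul, ← inner_eq_intervalIntegral hL.le,
    ← inner_eq_intervalIntegral hL.le, real_inner_self_eq_norm_sq] at h1
  have h4 : ⟪|v|, |w|⟫ ≤ ‖v‖ * ‖w‖ := by
    simpa [norm_abs_eq_norm] using real_inner_le_norm |v| |w|
  rw [inv_mul_cancel₀ hL.ne'] at h1
  nlinarith

end Spatial

/-! ### Multiplication by the exponential weight -/

section Weight

variable {L : ℝ}

/-- The boundary layer weight `exp (-a x)`. -/
def expW (a x : ℝ) : ℝ := Real.exp (-(a * x))

theorem expW_pos (a x : ℝ) : 0 < expW a x := Real.exp_pos _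

theorem expW_le_one {a x : ℝ} (ha : 0 ≤ a) (hx : 0 ≤ x) : expW a x ≤ 1 :=
  Real.exp_le_one_iff.2 (by nlinarith)

theorem hasDerivAt_expW (a x : ℝ) : HasDerivAt (expW a) (-a * expW a x) x := by
  have h := (((hasDerivAt_id x).const_mul a).neg).exp
  simp only [id, mul_one] at h
  exact h.congr_deriv (mul_comm _ _)

theorem continuous_expW (a : ℝ) : Continuous (expW a) := by
  unfold expW; fun_prop

theorem memLp_expW_mul {a : ℝ} (ha : 0 ≤ a) (w : L2 L) :
    MemLp (fun x => expW a x * w x) 2 (volume.restrict (Ioo 0 L)) := by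
  refine (Lp.memLp w).mono
    ((continuous_expW a).aestronglyMeasurable.mul (Lp.aestronglyMeasurable w)) ?_
  filter_upwards [ae_restrict_mem measurableSet_Ioo] with x hx
  rw [norm_mul, Real.norm_of_nonneg (expW_pos a x).le]
  exact mul_le_of_le_one_left (norm_nonneg _) (expW_le_one ha hx.1.le)

/-- Multiplication by the weight `exp (-a x)` on `L²(0, L)`. -/
def mulExpW (L : ℝ) {a : ℝ} (ha : 0 ≤ a) : L2 L →L[ℝ] L2 L :=
  LinearMap.mkContinuous
    { toFun := fun w => toL2 L (fun x => expW a x * w x)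
      map_add' := fun v w => by
        apply Lp.ext
        filter_upwards [coeFn_toL2 (memLp_expW_mul ha (v + w)), coeFn_toL2 (memLp_expW_mul ha v),
          coeFn_toL2 (memLp_expW_mul ha w), Lp.coeFn_add v w,
          Lp.coeFn_add (toL2 L (fun x => expW a x * v x)) (toL2 L (fun x => expW a x * w x))]
          with x h1 h2 h3 h4 h5
        rw [h1, h5, Pi.add_apply, h2, h3, h4, Pi.add_apply, mul_add]
      map_smul' := fun b w => by
        apply Lp.ext
        filter_upwards [coeFn_toL2 (memLp_expW_mul ha (b • w)), coeFn_toL2 (memLp_expW_mul ha w),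
          Lp.coeFn_smul b w,
          Lp.coeFn_smul b (toL2 L (fun x => expW a x * w x))] with x h1 h2 h4 h5
        simp only [RingHom.id_apply]
        rw [h1, h5, Pi.smul_apply, h2, h4, Pi.smul_apply, smul_eq_mul, smul_eq_mul]
        ring }
    1
    (fun w => by
      rw [one_mul]
      refine Lp.norm_le_norm_of_ae_le ?_
      filter_upwards [coeFn_toL2 (memLp_expW_mul ha w), ae_restrict_mem measurableSet_Ioo]
        with x h1 h2
      simp only [LinearMap.coe_mk, AddHom.coe_mk]
      rw [h1, norm_mul, Real.norm_of_nonneg (expW_pos a x).le]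
      exact mul_le_of_le_one_left (norm_nonneg _) (expW_le_one ha h2.1.le))

theorem coeFn_mulExpW {a : ℝ} (ha : 0 ≤ a) (w : L2 L) :
    mulExpW L ha w =ᵐ[volume.restrict (Ioo 0 L)] fun x => expW a x * w x :=
  coeFn_toL2 (memLp_expW_mul ha w)

theorem inner_mulExpW (hL : 0 ≤ L) {a : ℝ} (ha : 0 ≤ a) (v w : L2 L) :
    ⟪mulExpW L ha v, w⟫ = ∫ x in (0 : ℝ)..L, expW a x * (v x * w x) := by
  rw [inner_eq_intervalIntegral hL]
  refine intervalIntegral.integral_congr_ae ((ae_Ioo_iff_ae_uIoc hL).1 ?_)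
  filter_upwards [coeFn_mulExpW ha v] with x hx
  rw [hx, mul_assoc]

theorem intervalIntegrable_expW_mul (hL : 0 ≤ L) (a : ℝ) (v w : L2 L) :
    IntervalIntegrable (fun x => expW a x * (v x * w x)) volume 0 L :=
  (intervalIntegrable_mul_coe hL v w).continuousOn_mul (continuous_expW a).continuousOn

theorem inner_mulExpW_comm (hL : 0 ≤ L) {a : ℝ} (ha : 0 ≤ a) (v w : L2 L) :
    ⟪mulExpW L ha v, w⟫ = ⟪mulExpW L ha w, v⟫ := by
  rw [inner_mulExpW hL, inner_mulExpW hL]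
  simp only [mul_comm]

theorem norm_mulExpW_sq_le (hL : 0 ≤ L) {a : ℝ} (ha : 0 ≤ a) (v : L2 L) :
    ‖mulExpW L ha v‖ ^ 2 ≤ ⟪mulExpW L ha v, v⟫ := by
  rw [← real_inner_self_eq_norm_sq, inner_mulExpW hL, inner_mulExpW hL]
  refine intervalIntegral.integral_mono_ae_restrict hL (intervalIntegrable_expW_mul hL _ _ _)
    (intervalIntegrable_expW_mul hL _ _ _) ?_
  rw [← Measure.restrict_congr_set (Ioo_ae_eq_Icc (a := (0 : ℝ)) (b := L))]
  filter_upwards [coeFn_mulExpW ha v, ae_restrict_mem measurableSet_Ioo] with x h1 hx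
  rw [h1]
  have h2 := expW_le_one ha hx.1.le
  have h3 := expW_pos a x
  nlinarith [mul_nonneg h3.le (mul_self_nonneg (v x)), mul_self_nonneg (v x)]

theorem inner_mulExpW_nonneg (hL : 0 ≤ L) {a : ℝ} (ha : 0 ≤ a) (v : L2 L) :
    0 ≤ ⟪mulExpW L ha v, v⟫ :=
  (sq_nonneg _).trans (norm_mulExpW_sq_le hL ha v)

/-- A function in `H¹(0, L)` vanishing at `0` is controlled, in the layer of width `a⁻¹`, by its
derivative. -/
theorem inner_mulExpW_J_le (hL : 0 ≤ L) {a : ℝ} (ha : 0 ≤ a) (w : L2 L) :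
    a * ⟪mulExpW L ha (J hL w), J hL w⟫ ≤ 2 * ⟪mulExpW L ha (J hL w), w⟫ := by
  have h := integral_weight_sq 0 w (θ := expW a) (θ' := fun x => -a * expW a x)
    (hasDerivAt_expW a) (by have := continuous_expW a; fun_prop) (right_mem_Icc.2 hL)
  rw [inner_mulExpW hL, inner_mulExpW hL]
  have h2 : ∫ y in (0 : ℝ)..L, (-a * expW a y * prim 0 w y ^ 2
        + 2 * (expW a y * (prim 0 w y * w y)))
      = ∫ y in (0 : ℝ)..L, (-a * (expW a y * (J hL w y * J hL w y))
        + 2 * (expW a y * (J hL w y * w y))) := by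
    refine intervalIntegral.integral_congr_ae ((ae_Ioo_iff_ae_uIoc hL).1 ?_)
    filter_upwards [coeFn_J hL w] with x hx
    rw [hx]; ring
  rw [h2, intervalIntegral.integral_add ((intervalIntegrable_expW_mul hL _ _ _).const_mul _)
    ((intervalIntegrable_expW_mul hL _ _ _).const_mul _), intervalIntegral.integral_const_mul,
    intervalIntegral.integral_const_mul] at h
  have := mul_nonneg (expW_pos a L).le (sq_nonneg (prim 0 w L))
  linarith

/-- **Hardy-type inequality** `a² ∫ exp (-a x) v² ≤ 4 ‖v'‖²` for `v ∈ H¹(0, L)` with `v(0) = 0`. -/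
theorem inner_mulExpW_J_le_norm (hL : 0 ≤ L) {a : ℝ} (ha : 0 ≤ a) (w : L2 L) :
    a ^ 2 * ⟪mulExpW L ha (J hL w), J hL w⟫ ≤ 4 * ‖w‖ ^ 2 := by
  have h1 := inner_mulExpW_J_le hL ha w
  have h2 := norm_mulExpW_sq_le hL ha (J hL w)
  have h3 := real_inner_le_norm (mulExpW L ha (J hL w)) w
  set X := ⟪mulExpW L ha (J hL w), J hL w⟫
  set n := ‖mulExpW L ha (J hL w)‖
  have h4 : a * X ≤ 2 * (n * ‖w‖) := by linarith
  have hX : 0 ≤ X := inner_mulExpW_nonneg hL ha _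
  -- Young: `2 n ‖w‖ ≤ (a/2) n² + (2/a) ‖w‖²`, multiplied through by `a`
  nlinarith [sq_nonneg (a * n - 2 * ‖w‖), mul_nonneg ha (mul_nonneg ha (sub_nonneg.2 h2)),
    mul_le_mul_of_nonneg_left h4 ha]

theorem integral_expW_le (L : ℝ) {a : ℝ} (ha : 0 < a) :
    ∫ x in (0 : ℝ)..L, expW a x ≤ a⁻¹ := by
  have h : ∫ x in (0 : ℝ)..L, -a * expW a x = expW a L - expW a 0 :=
    intervalIntegral.integral_eq_sub_of_hasDerivAt (fun x _ => hasDerivAt_expW a x)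
      ((continuous_const.mul (continuous_expW a)).intervalIntegrable _ _)
  rw [intervalIntegral.integral_const_mul] at h
  have h0 : expW a 0 = 1 := by simp [expW]
  rw [h0] at h
  have := expW_pos a L
  rw [← one_div, le_div_iff₀ ha]
  linarith

/-- Pairing with a function of boundary layer type: it is seen only through the weighted norm, up to
an error proportional to the width `a⁻¹` of the layer. -/
theorem inner_le_of_abs_le_expW (hL : 0 ≤ L) {a : ℝ} (ha : 0 < a) {v k : L2 L}
    (hk : ∀ᵐ x ∂(volume.restrict (Ioo 0 L)), |k x| ≤ expW a x) {η : ℝ} (hη : 0 < η) :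
    |⟪v, k⟫| ≤ η * ⟪mulExpW L ha.le v, v⟫ + (4 * η * a)⁻¹ := by
  have h1 : |⟪v, k⟫| ≤ ∫ x in (0 : ℝ)..L, |v x * k x| := by
    rw [inner_eq_intervalIntegral hL]
    exact intervalIntegral.abs_integral_le_integral_abs hL
  have hi1 := (intervalIntegrable_expW_mul hL a v v).const_mul η
  have hi2 : IntervalIntegrable (fun x => (4 * η)⁻¹ * expW a x) volume 0 L :=
    (continuous_const.mul (continuous_expW a)).intervalIntegrable _ _
  have h2 : ∫ x in (0 : ℝ)..L, |v x * k x|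
      ≤ ∫ x in (0 : ℝ)..L, (η * (expW a x * (v x * v x)) + (4 * η)⁻¹ * expW a x) := by
    refine intervalIntegral.integral_mono_ae_restrict hL
      (intervalIntegrable_mul_coe hL v k).abs (hi1.add hi2) ?_
    rw [← Measure.restrict_congr_set (Ioo_ae_eq_Icc (a := (0 : ℝ)) (b := L))]
    filter_upwards [hk] with x hx
    have h3 : |v x| ≤ η * (v x * v x) + (4 * η)⁻¹ := by
      rw [← sub_nonneg]
      have : η * (v x * v x) + (4 * η)⁻¹ - |v x| = η * (|v x| - (2 * η)⁻¹) ^ 2 := by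
        rw [← abs_mul_abs_self (v x)]; field_simp; ring
      rw [this]; positivity
    rw [abs_mul]
    have h4 := expW_pos a x
    nlinarith [abs_nonneg (v x), mul_le_mul_of_nonneg_left hx (abs_nonneg (v x)),
      mul_le_mul_of_nonneg_left h3 h4.le]
  rw [intervalIntegral.integral_add hi1 hi2, intervalIntegral.integral_const_mul,
    intervalIntegral.integral_const_mul, ← inner_mulExpW hL ha.le] at h2
  have h3 := mul_le_mul_of_nonneg_left (integral_expW_le L ha) (by positivity : 0 ≤ (4 * η)⁻¹)
  rw [← mul_inv] at h3
  linarith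

/-- A `C¹` function as a primitive of its derivative. -/
theorem toL2_eq_smul_one_add_J (hL : 0 ≤ L) {k k' : ℝ → ℝ} (hk : ∀ x, HasDerivAt k (k' x) x)
    (hk' : Continuous k') : toL2 L k = k 0 • one L + J hL (toL2 L k') := by
  have hkc : Continuous k := continuous_iff_continuousAt.2 fun x => (hk x).continuousAt
  apply Lp.ext
  filter_upwards [coeFn_toL2 (memLp_of_continuousOn hkc.continuousOn),
    coeFn_smul_one_add_J hL (k 0) (toL2 L k'), ae_restrict_mem measurableSet_Ioo] with x h1 h2 hx
  rw [h1, h2, prim]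
  have h3 : ∫ y in (0 : ℝ)..x, (toL2 L k') y = ∫ y in (0 : ℝ)..x, k' y := by
    refine intervalIntegral.integral_congr_ae ?_
    filter_upwards [(ae_Ioo_iff_ae_uIoc hL).1
      (coeFn_toL2 (memLp_of_continuousOn (L := L) hk'.continuousOn))] with y hy hy'
    rw [uIoc_of_le hx.1.le] at hy'
    exact hy (by rw [uIoc_of_le hL]; exact ⟨hy'.1, hy'.2.trans hx.2.le⟩)
  rw [h3, intervalIntegral.integral_eq_sub_of_hasDerivAt (fun y _ => hk y)
    (hk'.intervalIntegrable _ _)]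
  ring

theorem coeFn_toL2_of_continuous {k : ℝ → ℝ} (hk : Continuous k) :
    toL2 L k =ᵐ[volume.restrict (Ioo 0 L)] k :=
  coeFn_toL2 (memLp_of_continuousOn hk.continuousOn)

theorem norm_le_of_ae_abs_le {v : L2 L} {C : ℝ} (hC : 0 ≤ C)
    (h : ∀ᵐ x ∂(volume.restrict (Ioo 0 L)), |v x| ≤ C) :
    ‖v‖ ≤ ((measureUnivNNReal (volume.restrict (Ioo (0 : ℝ) L)) : ℝ) ^ (2 : ℝ≥0∞).toReal⁻¹) * C :=
  Lp.norm_le_of_ae_bound hC h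

end Weight

/-! ### Weak derivatives -/

section WeakDeriv

variable {E : Type*} [NormedAddCommGroup E] {a b : ℝ}

theorem intervalIntegrable_of_integrableOn {w : ℝ → E} (hw : IntegrableOn w (Ioo a b)) {x y : ℝ}
    (hx : x ∈ Icc a b) (hy : y ∈ Icc a b) : IntervalIntegrable w volume x y := by
  have h : IntervalIntegrable w volume a b := by
    rwa [intervalIntegrable_iff_integrableOn_Ioo_of_le (hx.1.trans hx.2)]
  refine h.mono_set ?_
  rw [uIcc_of_le (hx.1.trans hx.2)]
  exact uIcc_subset_Icc hx hy

variable [InnerProductSpace ℝ E]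

theorem integrableOn_smul_of_tsupport {φ : ℝ → ℝ} (hφ : Continuous φ) (hc : HasCompactSupport φ)
    (hs : tsupport φ ⊆ Ioo a b) {v : ℝ → E} (hv : LocallyIntegrableOn v (Ioo a b)) :
    IntegrableOn (fun s => φ s • v s) (Ioo a b) := by
  have h1 : IntegrableOn v (tsupport φ) := hv.integrableOn_compact_subset hs hc
  have h2 : IntegrableOn (fun s => φ s • v s) (tsupport φ) :=
    h1.continuousOn_smul hφ.continuousOn hc
  refine (h2.integrable_of_forall_notMem_eq_zero fun x hx => ?_).integrableOn
  rw [image_eq_zero_of_notMem_tsupport hx, zero_smul]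

variable [CompleteSpace E]

theorem HasWeakDeriv.unique {v w w' : ℝ → E} (h : HasWeakDeriv a b v w)
    (h' : HasWeakDeriv a b v w') : w =ᵐ[volume.restrict (Ioo a b)] w' := by
  have h1 := isOpen_Ioo.ae_eq_zero_of_integral_contDiff_smul_eq_zero (μ := volume)
    (f := w - w') (U := Ioo a b) (h.2.1.sub h'.2.1) (fun φ hφ hc hs => by
      have h2 : ∫ s, φ s • (w - w') s = ∫ s in Ioo a b, φ s • (w - w') s := by
        refine (setIntegral_eq_integral_of_forall_compl_eq_zero fun x hx => ?_).symm
        rw [image_eq_zero_of_notMem_tsupport (fun hx' => hx (hs hx')), zero_smul]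
      rw [h2]
      simp only [Pi.sub_apply, smul_sub]
      rw [integral_sub (integrableOn_smul_of_tsupport hφ.continuous hc hs h.2.1)
        (integrableOn_smul_of_tsupport hφ.continuous hc hs h'.2.1), sub_eq_zero]
      have h3 := h.2.2 φ hφ hc hs
      rw [h'.2.2 φ hφ hc hs] at h3
      exact (neg_injective h3).symm)
  filter_upwards [(ae_restrict_iff' measurableSet_Ioo).2 h1] with x hx
  exact sub_eq_zero.1 hx

/-- The primitive of an integrable function has that function as its weak derivative. The identity
is scalar after pairing with a vector, and then integration by parts for absolutely continuous
functions applies. -/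
theorem integral_deriv_smul_primitive (hab : a < b) {w : ℝ → E} (hw : IntegrableOn w (Ioo a b))
    {φ : ℝ → ℝ} (hφ : ContDiff ℝ ∞ φ) (hs : tsupport φ ⊆ Ioo a b) :
    ∫ s in Ioo a b, deriv φ s • (∫ r in a..s, w r) = -∫ s in Ioo a b, φ s • w s := by
  have hwi : IntervalIntegrable w volume a b := by
    rwa [intervalIntegrable_iff_integrableOn_Ioo_of_le hab.le]
  have hφ' : Continuous (deriv φ) := hφ.continuous_deriv (by simp)
  have hV : ContinuousOn (fun s => ∫ r in a..s, w r) (uIcc a b) :=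
    intervalIntegral.continuousOn_primitive_interval (by
      rw [uIcc_of_le hab.le]; exact (integrableOn_Icc_iff_integrableOn_Ioo).2 hw)
  have hi1 : IntervalIntegrable (fun s => deriv φ s • (∫ r in a..s, w r)) volume a b :=
    (hφ'.continuousOn.smul hV).intervalIntegrable
  have hi2 : IntervalIntegrable (fun s => φ s • w s) volume a b :=
    hwi.continuousOn_smul hφ.continuous.continuousOn
  simp only [← integral_Ioc_eq_integral_Ioo, ← intervalIntegral.integral_of_le hab.le]
  refine ext_inner_left ℝ fun e => ?_
  have he : ∀ {f : ℝ → E} {x y : ℝ}, IntervalIntegrable f volume x y →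
      ⟪e, ∫ s in x..y, f s⟫ = ∫ s in x..y, ⟪e, f s⟫ := fun hf =>
    ((innerSL ℝ e).intervalIntegral_comp_comm hf).symm
  rw [inner_neg_right, he hi1, he hi2]
  have hwe : IntervalIntegrable (fun s => ⟪e, w s⟫) volume a b :=
    ⟨(innerSL ℝ e).integrable_comp hwi.1, (innerSL ℝ e).integrable_comp hwi.2⟩
  have hac1 : AbsolutelyContinuousOnInterval φ a b :=
    ((hφ.of_le (by exact_mod_cast le_top)).contDiffOn (n := 1)).absolutelyContinuousOnInterval
  have hac2 := hwe.absolutelyContinuousOnInterval_intervalIntegral (c := a) (by simp)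
  have key := hac1.integral_deriv_mul_eq_sub hac2
  have hφa : φ a = 0 := image_eq_zero_of_notMem_tsupport fun h => (hs h).1.false
  have hφb : φ b = 0 := image_eq_zero_of_notMem_tsupport fun h => (hs h).2.false
  rw [hφa, hφb, zero_mul, zero_mul, sub_zero] at key
  have hj2 : IntervalIntegrable (fun s => ⟪e, φ s • w s⟫) volume a b :=
    ⟨(innerSL ℝ e).integrable_comp hi2.1, (innerSL ℝ e).integrable_comp hi2.2⟩
  have hj1 : IntervalIntegrable (fun s => ⟪e, deriv φ s • (∫ r in a..s, w r)⟫) volume a b :=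
    ⟨(innerSL ℝ e).integrable_comp hi1.1, (innerSL ℝ e).integrable_comp hi1.2⟩
  rw [eq_neg_iff_add_eq_zero, ← intervalIntegral.integral_add hj1 hj2, ← key]
  refine intervalIntegral.integral_congr_ae ?_
  filter_upwards [hwe.ae_hasDerivAt_integral] with s hs1 hs2
  have hs3 := uIoc_subset_uIcc hs2
  rw [(hs1 hs3 a (by simp)).deriv, inner_smul_right, inner_smul_right, he]
  refine intervalIntegrable_of_integrableOn hw (left_mem_Icc.2 hab.le) ?_
  rwa [uIcc_of_le hab.le] at hs3

/-- **Du Bois-Reymond lemma**: a function with a vanishing weak derivative is constant. -/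
theorem exists_ae_eq_const (hab : a < b) {D : ℝ → E} (hD : LocallyIntegrableOn D (Ioo a b))
    (h : ∀ φ : ℝ → ℝ, ContDiff ℝ ∞ φ → HasCompactSupport φ → tsupport φ ⊆ Ioo a b →
      ∫ s in Ioo a b, deriv φ s • D s = 0) :
    ∃ c, ∀ᵐ t ∂(volume.restrict (Ioo a b)), D t = c := by
  -- with `∫ ρ = 1`, every test function is the sum of a multiple of `ρ` and of the derivative `q`
  -- of a test function; hence `D` is the constant `∫ ρ D`
  obtain ⟨ρ, hρ, hρc, hρs, hρ1, hρ0⟩ : ∃ ρ : ℝ → ℝ, ContDiff ℝ ∞ ρ ∧ HasCompactSupport ρ ∧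
      tsupport ρ ⊆ Ioo a b ∧ ∫ s in a..b, ρ s = 1 ∧ (tsupport ρ).Nonempty := by
    let β : ContDiffBump ((a + b) / 2) := ⟨(b - a) / 8, (b - a) / 4, by linarith, by linarith⟩
    have hsub : tsupport (β.normed volume) ⊆ Ioo a b := by
      rw [β.tsupport_normed_eq]
      intro x hx
      rw [Metric.mem_closedBall, Real.dist_eq, abs_le] at hx
      change _ ≤ _ ∧ _ ≤ (b - a) / 4 at hx
      have hx1 : -((b - a) / 4) ≤ x - (a + b) / 2 := hx.1
      constructor <;> linarith [hx.2]
    refine ⟨β.normed volume, β.contDiff_normed, β.hasCompactSupport_normed, hsub, ?_, ?_⟩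
    · rw [intervalIntegral.integral_of_le hab.le, integral_Ioc_eq_integral_Ioo,
        setIntegral_eq_integral_of_forall_compl_eq_zero, β.integral_normed]
      intro x hx
      exact image_eq_zero_of_notMem_tsupport fun hx' => hx (hsub hx')
    · rw [β.tsupport_normed_eq]
      exact ⟨_, Metric.mem_closedBall_self (by change 0 ≤ (b - a) / 4; linarith)⟩
  refine ⟨∫ s in Ioo a b, ρ s • D s, ?_⟩
  set c := ∫ s in Ioo a b, ρ s • D s with hcdef
  have h1 := isOpen_Ioo.ae_eq_zero_of_integral_contDiff_smul_eq_zero (μ := volume)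
    (f := fun s => D s - c) (U := Ioo a b) (hD.sub (locallyIntegrableOn_const c))
    (fun ψ hψ hψc hψs => by
      have h2 : ∫ s, ψ s • (D s - c) = ∫ s in Ioo a b, ψ s • (D s - c) := by
        refine (setIntegral_eq_integral_of_forall_compl_eq_zero fun x hx => ?_).symm
        rw [image_eq_zero_of_notMem_tsupport (fun hx' => hx (hψs hx')), zero_smul]
      rw [h2]
      set m := ∫ s in a..b, ψ s with hm
      set q : ℝ → ℝ := fun s => ψ s - m * ρ s with hq
      have hqd : ContDiff ℝ ∞ q := hψ.sub (contDiff_const.mul hρ)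
      have hqi : ∀ x y, IntervalIntegrable q volume x y := fun x y =>
        hqd.continuous.intervalIntegrable x y
      set φ : ℝ → ℝ := fun x => ∫ s in a..x, q s with hφdef
      have hφ' : ∀ x, HasDerivAt φ (q x) x := fun x =>
        intervalIntegral.integral_hasDerivAt_right (hqi _ _)
          (hqd.continuous.stronglyMeasurableAtFilter _ _) hqd.continuous.continuousAt
      have hderiv : deriv φ = q := funext fun x => (hφ' x).deriv
      have hφ : ContDiff ℝ ∞ φ :=
        contDiff_infty_iff_deriv.2 ⟨fun x => (hφ' x).differentiableAt, by rwa [hderiv]⟩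
      -- the union of the two supports lies in a compact interval `[a', b'] ⊂ (a, b)`
      have hK : IsCompact (tsupport ψ ∪ tsupport ρ) := hψc.isCompact.union hρc.isCompact
      have hKn : (tsupport ψ ∪ tsupport ρ).Nonempty := hρ0.mono subset_union_right
      have hKs : tsupport ψ ∪ tsupport ρ ⊆ Ioo a b := union_subset hψs hρs
      obtain ⟨a', ha'⟩ := hK.exists_isLeast hKn
      obtain ⟨b', hb'⟩ := hK.exists_isGreatest hKn
      have hq0 : ∀ x, x ∉ tsupport ψ ∪ tsupport ρ → q x = 0 := fun x hx => by
        have h3 : x ∉ tsupport ψ := fun h' => hx (Or.inl h')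
        have h4 : x ∉ tsupport ρ := fun h' => hx (Or.inr h')
        simp only [hq, image_eq_zero_of_notMem_tsupport h3, image_eq_zero_of_notMem_tsupport h4,
          mul_zero, sub_zero]
      have hqab : ∫ s in a..b, q s = 0 := by
        simp only [hq]
        rw [intervalIntegral.integral_sub (hψ.continuous.intervalIntegrable _ _)
          ((hρ.continuous.intervalIntegrable _ _).const_mul m),
          intervalIntegral.integral_const_mul, hρ1, ← hm]
        ring
      have hφ0 : ∀ x, x ∉ Icc a' b' → φ x = 0 := fun x hx => by
        rcases lt_or_ge x a' with hxa | hxa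
        · refine (intervalIntegral.integral_congr (g := fun _ => (0 : ℝ)) fun s hs =>
            hq0 s ?_).trans (by simp)
          intro hs'
          have h3 := ha'.2 hs'
          have h4 := (hKs ha'.1).1
          rcases mem_uIcc.1 hs with h5 | h5 <;> linarith [h5.1, h5.2]
        · have hxb : b' < x := not_le.1 fun h' => hx ⟨hxa, h'⟩
          have : ∫ s in x..b, q s = 0 := by
            refine (intervalIntegral.integral_congr (g := fun _ => (0 : ℝ))
              fun s hs => hq0 s ?_).trans (by simp)
            intro hs'
            have h3 := hb'.2 hs'
            have h4 := (hKs hb'.1).2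
            rcases mem_uIcc.1 hs with h5 | h5 <;> linarith [h5.1, h5.2]
          have h3 := intervalIntegral.integral_add_adjacent_intervals (hqi a x) (hqi x b)
          rw [this, hqab, add_zero] at h3
          exact h3
      have hφs : tsupport φ ⊆ Icc a' b' :=
        closure_minimal (fun x hx => by by_contra h'; exact hx (hφ0 x h')) isClosed_Icc
      have hφc : HasCompactSupport φ := isCompact_Icc.of_isClosed_subset (isClosed_tsupport _) hφs
      have h3 := h φ hφ hφc (hφs.trans fun x hx =>
        ⟨(hKs ha'.1).1.trans_le hx.1, hx.2.trans_lt (hKs hb'.1).2⟩)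
      have hi1 := integrableOn_smul_of_tsupport hψ.continuous hψc hψs hD
      have hi2 := integrableOn_smul_of_tsupport hρ.continuous hρc hρs hD
      have hi3 : IntegrableOn (fun s => ψ s • c) (Ioo a b) :=
        integrableOn_smul_of_tsupport hψ.continuous hψc hψs (locallyIntegrableOn_const c)
      simp only [hderiv, hq, sub_smul, mul_smul] at h3
      have hi4 : IntegrableOn (fun s => m • ρ s • D s) (Ioo a b) := hi2.smul m
      rw [integral_sub hi1 hi4, integral_smul, ← hcdef, sub_eq_zero] at h3
      simp only [smul_sub]
      rw [integral_sub hi1 hi3, h3, integral_smul_const, ← integral_Ioc_eq_integral_Ioo,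
        ← intervalIntegral.integral_of_le hab.le, ← hm, sub_self])
  filter_upwards [(ae_restrict_iff' measurableSet_Ioo).2 h1] with x hx
  exact sub_eq_zero.1 hx

/-- A function with an integrable weak derivative is a primitive of it. -/
theorem HasWeakDeriv.exists_ae_eq_primitive (hab : a < b) {v w : ℝ → E}
    (h : HasWeakDeriv a b v w) (hw : IntegrableOn w (Ioo a b)) :
    ∃ c, ∀ᵐ t ∂(volume.restrict (Ioo a b)), v t = c + ∫ s in a..t, w s := by
  have hV : ContinuousOn (fun s => ∫ r in a..s, w r) (Icc a b) := by
    have := intervalIntegral.continuousOn_primitive_interval (f := w) (μ := volume) (a := a)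
      (b := b) (by
      rw [uIcc_of_le hab.le]; exact (integrableOn_Icc_iff_integrableOn_Ioo).2 hw)
    rwa [uIcc_of_le hab.le] at this
  have hVl : LocallyIntegrableOn (fun s => ∫ r in a..s, w r) (Ioo a b) :=
    (hV.mono Ioo_subset_Icc_self).locallyIntegrableOn measurableSet_Ioo
  obtain ⟨c, hc⟩ := exists_ae_eq_const hab (h.1.sub hVl) fun φ hφ hφc hφs => by
    have hφ' : Continuous (deriv φ) := hφ.continuous_deriv (by simp)
    have hs' : tsupport (deriv φ) ⊆ tsupport φ := tsupport_deriv_subset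
    have h1 := integrableOn_smul_of_tsupport hφ' hφc.deriv (hs'.trans hφs) h.1
    have h2 := integrableOn_smul_of_tsupport hφ' hφc.deriv (hs'.trans hφs) hVl
    simp only [Pi.sub_apply, smul_sub]
    rw [integral_sub h1 h2, h.2.2 φ hφ hφc hφs,
      integral_deriv_smul_primitive hab hw hφ hφs, sub_self]
  refine ⟨c, ?_⟩
  filter_upwards [hc] with t ht
  rw [← ht]; simp

end WeakDeriv

/-! ### Lipschitz paths in Hilbert space and an energy inequality -/

section Paths

variable {E F : Type*} [NormedAddCommGroup E] [NormedAddCommGroup F] {T : ℝ}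

theorem integrableOn_of_memLp_top {v : ℝ → E} (h : MemLp v ∞ (volume.restrict (Ioo 0 T))) :
    IntegrableOn v (Ioo 0 T) :=
  h.integrable le_top

theorem exists_bound_of_memLp_top {v : ℝ → E} (h : MemLp v ∞ (volume.restrict (Ioo 0 T))) :
    ∃ M, 0 ≤ M ∧ ∀ᵐ t ∂(volume.restrict (Ioo 0 T)), ‖v t‖ ≤ M :=
  ⟨(eLpNorm v ∞ (volume.restrict (Ioo 0 T))).toReal, ENNReal.toReal_nonneg, by
    filter_upwards [ae_le_eLpNormEssSup (f := v) (μ := volume.restrict (Ioo 0 T))] with t ht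
    rw [← eLpNorm_exponent_top] at ht
    rw [← toReal_enorm]
    exact ENNReal.toReal_mono h.2.ne ht⟩

theorem memLp_top_of_continuousOn {v : ℝ → E} (h : ContinuousOn v (Icc 0 T)) :
    MemLp v ∞ (volume.restrict (Ioo 0 T)) := by
  obtain ⟨C, hC⟩ := isCompact_Icc.exists_bound_of_continuousOn h
  refine memLp_top_of_bound ((h.mono Ioo_subset_Icc_self).aestronglyMeasurable measurableSet_Ioo)
    C ?_
  filter_upwards [ae_restrict_mem measurableSet_Ioo] with t ht
  exact hC t (Ioo_subset_Icc_self ht)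

variable [NormedSpace ℝ E] [NormedSpace ℝ F]

theorem memLp_top_clm (A : E →L[ℝ] F) {v : ℝ → E}
    (h : MemLp v ∞ (volume.restrict (Ioo 0 T))) :
    MemLp (fun t => A (v t)) ∞ (volume.restrict (Ioo 0 T)) :=
  A.comp_memLp' h

/-- `v` is, up to a null set of times, the Lipschitz path on `(0, T)` with initial value `c` and
velocity `v' ∈ L^∞(0, T)`. -/
def IsPath (T : ℝ) (v v' : ℝ → E) (c : E) : Prop :=
  MemLp v' ∞ (volume.restrict (Ioo 0 T)) ∧
    ∀ᵐ t ∂(volume.restrict (Ioo 0 T)), v t = c + ∫ s in (0 : ℝ)..t, v' s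

namespace IsPath

variable {v w v' w' : ℝ → E} {c d : E}

theorem intervalIntegrable_zero (h : IsPath T v v' c) {t : ℝ} (ht : t ∈ Ioo 0 T) :
    IntervalIntegrable v' volume 0 t :=
  intervalIntegrable_of_integrableOn (integrableOn_of_memLp_top h.1)
    (left_mem_Icc.2 (ht.1.trans ht.2).le) (Ioo_subset_Icc_self ht)

theorem congr (hv : IsPath T v v' c) (h : v =ᵐ[volume.restrict (Ioo 0 T)] w) :
    IsPath T w v' c := by
  refine ⟨hv.1, ?_⟩
  filter_upwards [hv.2, h] with t h1 h2
  rw [← h2, h1]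

theorem add (hv : IsPath T v v' c) (hw : IsPath T w w' d) :
    IsPath T (fun t => v t + w t) (fun t => v' t + w' t) (c + d) := by
  refine ⟨hv.1.add hw.1, ?_⟩
  filter_upwards [hv.2, hw.2, ae_restrict_mem measurableSet_Ioo] with t h1 h2 ht
  rw [h1, h2, intervalIntegral.integral_add (hv.intervalIntegrable_zero ht)
    (hw.intervalIntegrable_zero ht)]
  abel

theorem norm_sub_le (hv : IsPath T v v' c) {M : ℝ}
    (hM : ∀ᵐ t ∂(volume.restrict (Ioo 0 T)), ‖v' t‖ ≤ M) {s t : ℝ} (hs : s ∈ Ioo 0 T)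
    (ht : t ∈ Ioo 0 T) (hvs : v s = c + ∫ r in (0 : ℝ)..s, v' r)
    (hvt : v t = c + ∫ r in (0 : ℝ)..t, v' r) : ‖v t - v s‖ ≤ M * |t - s| := by
  rw [hvs, hvt, add_sub_add_left_eq_sub, intervalIntegral.integral_interval_sub_left
    (hv.intervalIntegrable_zero ht) (hv.intervalIntegrable_zero hs)]
  refine intervalIntegral.norm_integral_le_of_norm_le_const_ae ?_
  filter_upwards [(ae_restrict_iff' measurableSet_Ioo).1 hM] with r hr hr'
  refine hr ?_
  have h1 := uIoc_subset_uIcc hr'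
  exact ordConnected_Ioo.uIcc_subset hs ht h1

theorem memLp_top (hv : IsPath T v v' c) : MemLp v ∞ (volume.restrict (Ioo 0 T)) := by
  rcases le_or_gt T 0 with hT | hT
  · simp [Ioo_eq_empty hT.not_gt]
  refine (memLp_top_of_continuousOn (T := T) (v := fun t => c + ∫ s in (0 : ℝ)..t, v' s)
    (continuousOn_const.add ?_)).ae_eq (EventuallyEq.symm hv.2)
  have := intervalIntegral.continuousOn_primitive_interval (f := v') (μ := volume) (a := 0)
    (b := T) (by
      rw [uIcc_of_le hT.le, integrableOn_Icc_iff_integrableOn_Ioo]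
      exact integrableOn_of_memLp_top hv.1)
  rwa [uIcc_of_le hT.le] at this

/-- A path with a continuous representative starts at the initial value of the latter. -/
theorem eq_of_continuousOn (hT : 0 < T) (hv : IsPath T v v' c) (hc : ContinuousOn v (Icc 0 T)) :
    c = v 0 := by
  have h1 : EqOn v (fun t => c + ∫ s in (0 : ℝ)..t, v' s) (Icc 0 T) := by
    refine Measure.eqOn_Icc_of_ae_eq volume hT.ne ?_ hc ?_
    · rw [Measure.restrict_congr_set Ioo_ae_eq_Icc.symm]; exact hv.2
    · refine continuousOn_const.add ?_
      have := intervalIntegral.continuousOn_primitive_interval (f := v') (μ := volume) (a := 0)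
        (b := T) (by
          rw [uIcc_of_le hT.le, integrableOn_Icc_iff_integrableOn_Ioo]
          exact integrableOn_of_memLp_top hv.1)
      rwa [uIcc_of_le hT.le] at this
  simpa using (h1 (left_mem_Icc.2 hT.le)).symm

variable [CompleteSpace E] [CompleteSpace F]

theorem map (A : E →L[ℝ] F) (hv : IsPath T v v' c) :
    IsPath T (fun t => A (v t)) (fun t => A (v' t)) (A c) := by
  refine ⟨memLp_top_clm A hv.1, ?_⟩
  filter_upwards [hv.2, ae_restrict_mem measurableSet_Ioo] with t h1 ht
  rw [h1, map_add, A.intervalIntegral_comp_comm (hv.intervalIntegrable_zero ht)]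

theorem sub (hv : IsPath T v v' c) (hw : IsPath T w w' d) :
    IsPath T (fun t => v t - w t) (fun t => v' t - w' t) (c - d) := by
  simpa [sub_eq_add_neg] using hv.add (hw.map (-ContinuousLinearMap.id ℝ E))

/-- The path `0` has initial value and velocity `0`. -/
theorem eq_zero (hT : 0 < T) (hv : IsPath T v v' c) (h : v =ᵐ[volume.restrict (Ioo 0 T)] 0) :
    c = 0 ∧ v' =ᵐ[volume.restrict (Ioo 0 T)] 0 := by
  have hv0 := hv.congr h
  have hc : c = 0 := hv0.eq_of_continuousOn hT continuousOn_const
  refine ⟨hc, ?_⟩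
  have hi : IntegrableOn v' (Icc 0 T) := by
    rw [integrableOn_Icc_iff_integrableOn_Ioo]; exact integrableOn_of_memLp_top hv.1
  have h1 : EqOn (fun _ => 0) (fun t => c + ∫ s in (0 : ℝ)..t, v' s) (Icc 0 T) := by
    refine Measure.eqOn_Icc_of_ae_eq volume hT.ne ?_ continuousOn_const ?_
    · rw [Measure.restrict_congr_set Ioo_ae_eq_Icc.symm]; exact hv0.2
    · refine continuousOn_const.add ?_
      have := intervalIntegral.continuousOn_primitive_interval (f := v') (μ := volume) (a := 0)
        (b := T) (by rwa [uIcc_of_le hT.le])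
      rwa [uIcc_of_le hT.le] at this
  have h2 : IntervalIntegrable v' volume 0 T := by
    rw [intervalIntegrable_iff_integrableOn_Ioo_of_le hT.le]
    exact integrableOn_of_memLp_top hv.1
  have h3 := (ae_restrict_iff' (measurableSet_Ioo (a := 0) (b := T))).2
    (h2.ae_hasDerivAt_integral.mono fun x hx hx' =>
      hx (by rw [uIcc_of_le hT.le]; exact Ioo_subset_Icc_self hx') 0 (by simp))
  filter_upwards [h3, ae_restrict_mem measurableSet_Ioo] with t ht1 ht2
  have h4 : HasDerivAt (fun x => ∫ s in (0 : ℝ)..x, v' s) 0 t := by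
    refine (hasDerivAt_const t (0 : E)).congr_of_eventuallyEq ?_
    filter_upwards [Ioo_mem_nhds ht2.1 ht2.2] with y hy
    have := h1 (Ioo_subset_Icc_self hy)
    rw [hc] at this
    simpa using this.symm
  exact ht1.unique h4

end IsPath

end Paths

section Energy

variable {E : Type*} [NormedAddCommGroup E] [InnerProductSpace ℝ E] [CompleteSpace E] {T : ℝ}

theorem HasWeakDeriv.exists_isPath (hT : 0 < T) {v v' : ℝ → E} (h : HasWeakDeriv 0 T v v')
    (hv' : MemLp v' ∞ (volume.restrict (Ioo 0 T))) : ∃ c, IsPath T v v' c := by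
  obtain ⟨c, hc⟩ := h.exists_ae_eq_primitive hT (integrableOn_of_memLp_top hv')
  exact ⟨c, hv', hc⟩

/-- A Lipschitz function whose derivative is almost everywhere at most `D` grows by at most
`∫ D`. -/
theorem le_integral_of_lipschitz {K : NNReal} {N D : ℝ → ℝ} {t : ℝ} (ht : 0 ≤ t)
    (hN : LipschitzWith K N) (hN0 : N 0 ≤ 0) (hD : IntervalIntegrable D volume 0 t)
    (h : ∀ᵐ s, s ∈ Ioo 0 t → deriv N s ≤ D s) : N t ≤ ∫ s in (0 : ℝ)..t, D s := by
  have hac : AbsolutelyContinuousOnInterval N 0 t :=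
    (hN.lipschitzOnWith (s := uIcc 0 t)).absolutelyContinuousOnInterval
  have h1 := hac.integral_deriv_eq_sub
  have h2 : ∫ s in (0 : ℝ)..t, deriv N s ≤ ∫ s in (0 : ℝ)..t, D s := by
    refine intervalIntegral.integral_mono_ae_restrict ht hac.intervalIntegrable_deriv hD ?_
    rw [← Measure.restrict_congr_set (Ioo_ae_eq_Icc (a := (0 : ℝ)) (b := t))]
    exact (ae_restrict_iff' measurableSet_Ioo).2 h
  linarith

/-- **Energy inequality.** Let `v` be a Lipschitz path starting at `0`, and `a t = A (v t)` for a
symmetric and monotone, possibly unbounded, linear `A`, with `a` essentially bounded. Then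
`⟪A v, v⟫ (t) ≤ ∫₀ᵗ 2 ⟪A v, v'⟫`. Only differences of values of `v` and of `a` at times of a set of
full measure enter, so that neither path has to be continuous. -/
theorem IsPath.inner_le_integral {v v' a : ℝ → E} (hv : IsPath T v v' 0)
    (ha : MemLp a ∞ (volume.restrict (Ioo 0 T))) (P : ℝ → Prop)
    (hP : ∀ᵐ t ∂(volume.restrict (Ioo 0 T)), P t)
    (hsymm : ∀ s t, P s → P t → ⟪a t, v s⟫ = ⟪a s, v t⟫)
    (hmono : ∀ s t, P s → P t → 0 ≤ ⟪a t - a s, v t - v s⟫) :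
    ∀ᵐ t ∂(volume.restrict (Ioo 0 T)), ⟪a t, v t⟫ ≤ ∫ s in (0 : ℝ)..t, 2 * ⟪a s, v' s⟫ := by
  obtain ⟨M, hM0, hM⟩ := exists_bound_of_memLp_top hv.1
  obtain ⟨K, hK0, hK⟩ := exists_bound_of_memLp_top ha
  set S : Set ℝ := {t | t ∈ Ioo 0 T ∧ P t ∧ ‖a t‖ ≤ K ∧ v t = 0 + ∫ s in (0 : ℝ)..t, v' s}
    with hS
  have hSae : ∀ᵐ t ∂(volume.restrict (Ioo 0 T)), t ∈ S := by
    filter_upwards [hP, hK, hv.2, ae_restrict_mem measurableSet_Ioo] with t h1 h2 h3 h4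
    exact ⟨h4, h1, h2, h3⟩
  have hSae' := (ae_restrict_iff' measurableSet_Ioo).1 hSae
  have hlip : ∀ s ∈ S, ∀ t ∈ S, ‖v t - v s‖ ≤ M * |t - s| := fun s hs t ht =>
    hv.norm_sub_le hM hs.1 ht.1 hs.2.2.2 ht.2.2.2
  -- expand `⟪a t - a s, v t - v s⟫ ≥ 0`
  have hdiff : ∀ s ∈ S, ∀ t ∈ S, ⟪a t, v t⟫ - ⟪a s, v s⟫ ≤ 2 * ⟪a t, v t - v s⟫ := by
    intro s hs t ht
    have h1 := hmono s t hs.2.1 ht.2.1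
    have h2 := hsymm s t hs.2.1 ht.2.1
    simp only [inner_sub_left, inner_sub_right] at h1 ⊢
    linarith
  have hdiff' : ∀ s ∈ S, ∀ t ∈ S, ⟪a t, v t⟫ - ⟪a s, v s⟫ ≤ 2 * K * M * |t - s| := by
    intro s hs t ht
    have h1 := hdiff s hs t ht
    have h2 := real_inner_le_norm (a t) (v t - v s)
    have h3 := mul_le_mul ht.2.2.1 (hlip s hs t ht) (norm_nonneg _) hK0
    linarith
  have hNlip : LipschitzOnWith (2 * K * M).toNNReal (fun t => ⟪a t, v t⟫) S := by
    refine LipschitzOnWith.of_dist_le_mul fun t ht s hs => ?_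
    rw [Real.coe_toNNReal _ (by positivity), Real.dist_eq, Real.dist_eq, abs_le]
    have h1 := hdiff' s hs t ht
    have h2 := hdiff' t ht s hs
    rw [abs_sub_comm] at h2
    constructor <;> linarith
  -- `⟪a, v⟫` is defined only almost everywhere: pass to a Lipschitz function on the line that
  -- agrees with it on `S`
  obtain ⟨N, hN, hNS⟩ := hNlip.extend_real
  -- a set of full measure meets every interval
  have hdense : ∀ s ∈ Ico 0 T, ∀ r > s, ∃ q ∈ Ioo s r, q ∈ S := by
    intro s hs r hr
    by_contra! hcon
    have h1 : volume (Ioo s (min r T)) = 0 := by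
      refine measure_mono_null (t := {q | ¬ (q ∈ Ioo 0 T → q ∈ S)})
        (fun q hq hq' => ?_) hSae'
      exact hcon q ⟨hq.1, hq.2.trans_le (min_le_left _ _)⟩
        (hq' ⟨hs.1.trans_lt hq.1, hq.2.trans_le (min_le_right _ _)⟩)
    rw [Real.volume_Ioo, ENNReal.ofReal_eq_zero] at h1
    have : s < min r T := lt_min hr hs.2
    linarith
  have hN0 : ∀ _ : 0 < T, N 0 ≤ 0 := by
    intro hT
    by_contra! hcon
    set B := 2 * K * M + K * M + 1 with hB
    have hBpos : 0 < B := by positivity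
    obtain ⟨q, hq, hqS⟩ := hdense 0 ⟨le_rfl, hT⟩ (N 0 / B) (by positivity)
    have h1 : N 0 - N q ≤ 2 * K * M * q := by
      have := hN.dist_le_mul 0 q
      rw [Real.coe_toNNReal _ (by positivity), Real.dist_eq, Real.dist_eq, zero_sub, abs_neg,
        abs_of_pos hq.1] at this
      exact (le_abs_self _).trans this
    have h2 : N q ≤ K * (M * q) := by
      rw [← hNS hqS]
      refine (real_inner_le_norm _ _).trans (mul_le_mul hqS.2.2.1 ?_ (norm_nonneg _) hK0)
      have h3 : ‖v q‖ ≤ M * |q - 0| := by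
        rw [hqS.2.2.2, zero_add]
        refine intervalIntegral.norm_integral_le_of_norm_le_const_ae ?_
        filter_upwards [(ae_restrict_iff' measurableSet_Ioo).1 hM] with r hr hr'
        rw [uIoc_of_le hqS.1.1.le] at hr'
        exact hr ⟨hr'.1, hr'.2.trans_lt hqS.1.2⟩
      rwa [sub_zero, abs_of_pos hq.1] at h3
    have h3 : B * q < N 0 := by
      have := hq.2
      rw [lt_div_iff₀ hBpos] at this
      linarith
    have h4 := hq.1
    nlinarith
  have hDint : IntegrableOn (fun s => 2 * ⟪a s, v' s⟫) (Ioo 0 T) := by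
    refine Integrable.const_mul ?_ 2
    refine Integrable.of_bound (C := K * M) (ha.1.inner hv.1.1) ?_
    filter_upwards [hK, hM] with t h1 h2
    exact (norm_inner_le_norm _ _).trans (mul_le_mul h1 h2 (norm_nonneg _) hK0)
  have hderiv : ∀ᵐ s, s ∈ Ioo 0 T → deriv N s ≤ 2 * ⟪a s, v' s⟫ := by
    rcases le_or_gt T 0 with hT | hT
    · exact Eventually.of_forall fun s hs => absurd (hs.1.trans hs.2) (not_lt.2 hT)
    have h2 : IntervalIntegrable v' volume 0 T := by
      rw [intervalIntegrable_iff_integrableOn_Ioo_of_le hT.le]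
      exact integrableOn_of_memLp_top hv.1
    filter_upwards [hSae', h2.ae_hasDerivAt_integral, hN.ae_differentiableAt_real]
      with t ht1 ht2 ht3 ht
    have htS := ht1 ht
    have hVd := ht2 (by rw [uIcc_of_le hT.le]; exact Ioo_subset_Icc_self ht) 0 (by simp)
    -- difference quotients from the left along `S`, where `hdiff` bounds them from above
    set F : Filter ℝ := 𝓝[S ∩ Iio t] t with hF
    have hFne : F.NeBot := by
      rw [hF, ← mem_closure_iff_nhdsWithin_neBot, Metric.mem_closure_iff]
      intro η hη
      have h0 : 0 ≤ max 0 (t - η) := le_max_left _ _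
      have h1 : max 0 (t - η) < t := max_lt ht.1 (by linarith)
      obtain ⟨q, hq, hqS⟩ := hdense (max 0 (t - η)) ⟨h0, h1.trans ht.2⟩ t h1
      refine ⟨q, ⟨hqS, hq.2⟩, ?_⟩
      rw [Real.dist_eq, abs_of_pos (sub_pos.2 hq.2)]
      linarith [(le_max_right 0 (t - η)).trans_lt hq.1]
    have hle : F ≤ 𝓝[≠] t := nhdsWithin_mono t fun q hq => ne_of_lt hq.2
    have hl1 := (hasDerivAt_iff_tendsto_slope.1 ht3.hasDerivAt).mono_left hle
    have hl2 := (hasDerivAt_iff_tendsto_slope.1 hVd).mono_left hle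
    have hl3 : Tendsto (fun q => 2 * ⟪a t, slope (fun x => ∫ s in (0 : ℝ)..x, v' s) t q⟫) F
        (𝓝 (2 * ⟪a t, v' t⟫)) :=
      (tendsto_const_nhds.inner hl2).const_mul 2
    refine le_of_tendsto_of_tendsto hl1 hl3 ?_
    filter_upwards [self_mem_nhdsWithin] with q hq
    have h3 := hdiff q hq.1 t htS
    have h4 : 0 < t - q := sub_pos.2 hq.2
    rw [slope_comm, slope_comm (fun x => ∫ s in (0 : ℝ)..x, v' s)]
    simp only [slope, vsub_eq_sub, smul_eq_mul, real_inner_smul_right]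
    rw [← hNS htS, ← hNS hq.1]
    have h5 : v t - v q = (∫ s in (0 : ℝ)..t, v' s) - ∫ s in (0 : ℝ)..q, v' s := by
      rw [htS.2.2.2, hq.1.2.2.2]; abel
    rw [← h5]
    have h6 := mul_le_mul_of_nonneg_left h3 (inv_nonneg.2 h4.le)
    linarith
  filter_upwards [hSae] with t htS
  have hT : 0 < T := htS.1.1.trans htS.1.2
  have := le_integral_of_lipschitz (t := t) (D := fun s => 2 * ⟪a s, v' s⟫) htS.1.1.le hN (hN0 hT)
    (intervalIntegrable_of_integrableOn hDint (left_mem_Icc.2 hT.le) (Ioo_subset_Icc_self htS.1))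
    (by
      filter_upwards [hderiv] with s hs hs'
      exact hs ⟨hs'.1, hs'.2.trans htS.1.2⟩)
  rwa [← hNS htS] at this

end Energy

/-! ### Dissipation estimates at a fixed time -/

section Estimates

variable {L : ℝ}

theorem inner_J_self_nonneg (hL : 0 ≤ L) (w : L2 L) : 0 ≤ ⟪J hL w, w⟫ := by
  have h := inner_smul_one_add_J hL 0 0 w w
  simp only [zero_smul, zero_add, mul_zero, sub_zero] at h
  rw [real_inner_comm (J hL w) w] at h
  linarith [mul_self_nonneg ⟪one L, w⟫]

theorem inner_J_self_eq_zero (hL : 0 ≤ L) {w : L2 L} (hw : ⟪one L, w⟫ = 0) : ⟪J hL w, w⟫ = 0 := by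
  have h := inner_smul_one_add_J hL 0 0 w w
  simp only [zero_smul, zero_add, mul_zero, sub_zero, hw] at h
  rw [real_inner_comm (J hL w) w] at h
  linarith

theorem inner_J_add_inner_J (hL : 0 ≤ L) {v : L2 L} (hv : ⟪one L, v⟫ = 0) (w : L2 L) :
    ⟪J hL v, w⟫ + ⟪v, J hL w⟫ = 0 := by
  have h := inner_smul_one_add_J hL 0 0 v w
  simpa [hv] using h

/-- Dissipation of the weighted energy `‖r‖² + l ⟪(1 + K exp (-α x / ε)) s, s⟫` for the error system
at a fixed time, with `K = l U α`. The weight turns the transport term of the undamped equation for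
`s` into the damping `(K² / 2ε) ∫ exp (-α x / ε) s²`, which absorbs both the forcing of boundary
layer type and the loss of symmetry caused by the weight itself. -/
theorem energy_dissipation (hL : 0 < L) {U l ε α K M β y z q : ℝ} (hl : 0 < l) (hU : 0 < U)
    (hα : 0 < α) (hε : 0 < ε) (hM : 0 < M) (hK : K = l * U * α) (hK1 : K ≤ 1)
    {rx rxx sx Φ k e : L2 L} (hrx : ⟪one L, rx⟫ = 0) (hrxx : rx = q • one L + J hL.le rxx)
    (hΦ : ‖Φ‖ ≤ M) (hy : |y| ≤ M) (hz : |z| ≤ M) (hβ : |β| ≤ M)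
    (hk : ∀ᵐ x ∂(volume.restrict (Ioo 0 L)), |k x| ≤ expW (α / ε) x)
    (he : ∀ᵐ x ∂(volume.restrict (Ioo 0 L)), |e x| ≤ expW (α / ε) x) (ha : 0 ≤ α / ε)
    {rt st : L2 L}
    (hrt : rt = -(U • rx) - sx + (2 * ε) • rxx + (ε • Φ + y • k + z • e))
    (hst : st = -(U • sx) - l⁻¹ • rx + β • k) :
    ⟪J hL.le rx, rt⟫ + l * ⟪J hL.le sx + K • mulExpW L ha (J hL.le sx), st⟫
      ≤ -(ε / 2) * ‖rx‖ ^ 2 + ε * M * ‖J hL.le rx‖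
        + (8 * M ^ 2 / α ^ 3 + 4 * l ^ 2 * M ^ 2 / (α * K ^ 2)) * ε ^ 2 := by
  have hK0 : 0 < K := by rw [hK]; positivity
  have hapos : 0 < α / ε := by positivity
  set r := J hL.le rx with hr
  set s := J hL.le sx with hs
  set m := mulExpW L ha s with hm
  set X := ⟪m, s⟫ with hX
  set Y := ⟪mulExpW L ha r, r⟫ with hY
  have f1 : ⟪r, rx⟫ = 0 := inner_J_self_eq_zero hL.le hrx
  have f2 : ⟪r, sx⟫ + ⟪rx, s⟫ = 0 := inner_J_add_inner_J hL.le hrx sx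
  have f3 : ⟪r, rxx⟫ = -‖rx‖ ^ 2 := by
    have h := inner_smul_one_add_J hL.le 0 q rx rxx
    rw [← hrxx, hrx, real_inner_self_eq_norm_sq] at h
    simp only [zero_smul, zero_add, zero_mul, sub_zero] at h
    linarith
  have f4 : 0 ≤ ⟪s, sx⟫ := inner_J_self_nonneg hL.le sx
  have f5 : α / ε * X ≤ 2 * ⟪m, sx⟫ := inner_mulExpW_J_le hL.le ha sx
  have f6 : ‖m‖ ^ 2 ≤ X := norm_mulExpW_sq_le hL.le ha s
  have f7 : |⟪m, rx⟫| ≤ ‖m‖ * ‖rx‖ := abs_real_inner_le_norm _ _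
  have f8 : (α / ε) ^ 2 * Y ≤ 4 * ‖rx‖ ^ 2 := inner_mulExpW_J_le_norm hL.le ha rx
  have f9 : |⟪r, Φ⟫| ≤ ‖r‖ * M :=
    (abs_real_inner_le_norm _ _).trans (mul_le_mul_of_nonneg_left hΦ (norm_nonneg _))
  -- forcing in the equation for `r`
  have hη1 : 0 < α ^ 2 / (16 * M * ε) := by positivity
  have g1 := inner_le_of_abs_le_expW hL.le hapos (v := r) hk hη1
  have g2 := inner_le_of_abs_le_expW hL.le hapos (v := r) he hη1
  -- forcing in the equation for `s`
  have hη2 : 0 < K ^ 2 / (8 * l * M * ε) := by positivity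
  have g3 := inner_le_of_abs_le_expW hL.le hapos (v := s) hk hη2
  have hmk : ⟪m, k⟫ = ⟪s, mulExpW L ha k⟫ := by
    rw [hm, inner_mulExpW_comm hL.le ha, real_inner_comm]
  have hk' : ∀ᵐ x ∂(volume.restrict (Ioo 0 L)), |mulExpW L ha k x| ≤ expW (α / ε) x := by
    filter_upwards [hk, coeFn_mulExpW ha k, ae_restrict_mem measurableSet_Ioo] with x h1 h2 h3
    rw [h2, abs_mul, abs_of_pos (expW_pos _ _)]
    exact (mul_le_of_le_one_left (abs_nonneg _) (expW_le_one ha h3.1.le)).trans h1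
  have g4 := inner_le_of_abs_le_expW hL.le hapos (v := s) hk' hη2
  rw [← hmk] at g4
  rw [← hY] at g1 g2
  rw [← hX] at g3 g4
  -- the parameter `α² / (16 M ε)` makes the two layer terms cost `(ε / 2) ‖rx‖²` in all, a quarter
  -- of the viscous dissipation `2 ε ‖rx‖²`
  have hYbound : α ^ 2 / (16 * M * ε) * Y ≤ ε / (4 * M) * ‖rx‖ ^ 2 := by
    have h1 : α ^ 2 / (16 * M * ε) * Y = ε / (16 * M) * ((α / ε) ^ 2 * Y) := by field_simp
    rw [h1]
    calc ε / (16 * M) * ((α / ε) ^ 2 * Y) ≤ ε / (16 * M) * (4 * ‖rx‖ ^ 2) := by gcongr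
      _ = ε / (4 * M) * ‖rx‖ ^ 2 := by field_simp; ring
  have hR : |y * ⟪r, k⟫ + z * ⟪r, e⟫| ≤ ε / 2 * ‖rx‖ ^ 2 + 8 * M ^ 2 / α ^ 3 * ε ^ 2 := by
    have h1 : (4 * (α ^ 2 / (16 * M * ε)) * (α / ε))⁻¹ = 4 * M * ε ^ 2 / α ^ 3 := by
      field_simp; norm_num
    rw [h1] at g1 g2
    calc |y * ⟪r, k⟫ + z * ⟪r, e⟫| ≤ |y| * |⟪r, k⟫| + |z| * |⟪r, e⟫| := by
          rw [← abs_mul, ← abs_mul]; exact abs_add_le _ _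
      _ ≤ M * (ε / (4 * M) * ‖rx‖ ^ 2 + 4 * M * ε ^ 2 / α ^ 3)
          + M * (ε / (4 * M) * ‖rx‖ ^ 2 + 4 * M * ε ^ 2 / α ^ 3) := by
        gcongr <;> linarith
      _ = ε / 2 * ‖rx‖ ^ 2 + 8 * M ^ 2 / α ^ 3 * ε ^ 2 := by field_simp; ring
  have hS : |l * β * (⟪s, k⟫ + K * ⟪m, k⟫)|
      ≤ K ^ 2 / (4 * ε) * X + 4 * l ^ 2 * M ^ 2 / (α * K ^ 2) * ε ^ 2 := by
    have h1 : (4 * (K ^ 2 / (8 * l * M * ε)) * (α / ε))⁻¹ = 2 * l * M * ε ^ 2 / (α * K ^ 2) := by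
      field_simp; norm_num
    rw [h1] at g3 g4
    have hB : 0 ≤ K ^ 2 / (8 * l * M * ε) * X + 2 * l * M * ε ^ 2 / (α * K ^ 2) :=
      (abs_nonneg _).trans g3
    calc |l * β * (⟪s, k⟫ + K * ⟪m, k⟫)| = l * |β| * |⟪s, k⟫ + K * ⟪m, k⟫| := by
          rw [abs_mul, abs_mul, abs_of_pos hl]
      _ ≤ l * M * (|⟪s, k⟫| + 1 * |⟪m, k⟫|) := by
          gcongr
          refine (abs_add_le _ _).trans ?_
          rw [abs_mul, abs_of_pos hK0]
          gcongr
      _ ≤ l * M * ((K ^ 2 / (8 * l * M * ε) * X + 2 * l * M * ε ^ 2 / (α * K ^ 2))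
          + 1 * (K ^ 2 / (8 * l * M * ε) * X + 2 * l * M * ε ^ 2 / (α * K ^ 2))) := by
        gcongr
      _ = K ^ 2 / (4 * ε) * X + 4 * l ^ 2 * M ^ 2 / (α * K ^ 2) * ε ^ 2 := by
        field_simp; ring
  -- the weight destroys the cancellation of `⟪r, sx⟫` against `⟪rx, s⟫`, and this is the defect
  have hcross : K * |⟪m, rx⟫| ≤ ε * ‖rx‖ ^ 2 + K ^ 2 / (4 * ε) * X := by
    have h1 : K * (‖m‖ * ‖rx‖) ≤ ε * ‖rx‖ ^ 2 + K ^ 2 / (4 * ε) * ‖m‖ ^ 2 := by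
      rw [← sub_nonneg]
      have : ε * ‖rx‖ ^ 2 + K ^ 2 / (4 * ε) * ‖m‖ ^ 2 - K * (‖m‖ * ‖rx‖)
        = ε * (‖rx‖ - K / (2 * ε) * ‖m‖) ^ 2 := by field_simp; ring
      rw [this]; positivity
    have h2 : K ^ 2 / (4 * ε) * ‖m‖ ^ 2 ≤ K ^ 2 / (4 * ε) * X := by gcongr
    have h3 := mul_le_mul_of_nonneg_left f7 hK0.le
    linarith
  -- the damping; by `hsplit`, one half is spent on `hcross` and the other on `hS`
  have hdamp : K ^ 2 / (2 * ε) * X ≤ l * U * K * ⟪m, sx⟫ := by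
    have h1 : K ^ 2 / (2 * ε) * X = l * U * K / 2 * (α / ε * X) := by
      rw [pow_two]; nth_rewrite 1 [hK]; field_simp
    rw [h1]
    calc l * U * K / 2 * (α / ε * X) ≤ l * U * K / 2 * (2 * ⟪m, sx⟫) := by gcongr
      _ = l * U * K * ⟪m, sx⟫ := by ring
  have hsplit : K ^ 2 / (2 * ε) * X = K ^ 2 / (4 * ε) * X + K ^ 2 / (4 * ε) * X := by
    field_simp; ring
  have hexp : ⟪r, rt⟫ + l * ⟪s + K • m, st⟫ = -U * ⟪r, rx⟫ - (⟪r, sx⟫ + ⟪rx, s⟫)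
      + 2 * ε * ⟪r, rxx⟫ + ε * ⟪r, Φ⟫ + (y * ⟪r, k⟫ + z * ⟪r, e⟫) - l * U * ⟪s, sx⟫
      - l * U * K * ⟪m, sx⟫ - K * ⟪m, rx⟫ + l * β * (⟪s, k⟫ + K * ⟪m, k⟫) := by
    rw [hrt, hst]
    simp only [inner_add_left, inner_add_right, inner_sub_right, inner_neg_right,
      real_inner_smul_left, real_inner_smul_right]
    rw [real_inner_comm s rx]
    field_simp
    ring
  rw [hexp, f1, f2, f3]
  have h1 := (le_abs_self _).trans hR
  have h2 := (le_abs_self _).trans hS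
  have h3 := (neg_le_abs _).trans (le_refl |⟪m, rx⟫|)
  have h4 := mul_le_mul_of_nonneg_left h3 hK0.le
  have h5 := mul_le_mul_of_nonneg_left ((le_abs_self _).trans f9) hε.le
  have h6 : 0 ≤ l * U * ⟪s, sx⟫ := by positivity
  rw [hsplit] at hdamp
  linarith

/-- The scalar inequality behind `deriv_dissipation`: `a`, `h`, `n` stand for `‖rx‖`, `‖rxx‖`,
`‖σ‖`, and `q` for the trace of `rx`. By Young's inequality the cross terms `y1`, `y2`, `y3`, `y5`
consume the dissipation `2 ε h²`, and `y2`, `y4` the damping `4 l (c / ε) n² = 2 n² / ε`. -/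
theorem dissipation_real {U l L ε c D₁ D₂ B M a h n q : ℝ} (hε : 0 < ε) (hε1 : ε ≤ 1)
    (hlc : l * c = 1 / 2) (hB0 : 0 < B) (hl : 0 < l) (hL : 0 < L)
    (e2 : q ^ 2 ≤ L⁻¹ * a ^ 2 + 2 * (a * h)) :
    -2 * ε * h ^ 2 + h * (U * a + n + D₁) + B * (M ^ 2 + l⁻¹ ^ 2 * q ^ 2)
      - 4 * l * (c / ε * n ^ 2) + 4 * l * (n * (D₂ / ε))
      ≤ (U ^ 2 + D₁ ^ 2 + 4 * l ^ 2 * D₂ ^ 2 + B * (M ^ 2 + l⁻¹ ^ 2 * L⁻¹)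
        + (B * l⁻¹ ^ 2) ^ 2) / ε * (1 + a ^ 2) := by
  have y1 : h * (U * a) ≤ ε / 4 * h ^ 2 + U ^ 2 * a ^ 2 / ε := by
    rw [← sub_nonneg]
    have : ε / 4 * h ^ 2 + U ^ 2 * a ^ 2 / ε - h * (U * a) = ε * (h / 2 - U * a / ε) ^ 2 := by
      field_simp; ring
    rw [this]; positivity
  have y2 : h * n ≤ ε / 4 * h ^ 2 + n ^ 2 / ε := by
    rw [← sub_nonneg]
    have : ε / 4 * h ^ 2 + n ^ 2 / ε - h * n = ε * (h / 2 - n / ε) ^ 2 := by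
      field_simp; ring
    rw [this]; positivity
  have y3 : h * D₁ ≤ ε / 4 * h ^ 2 + D₁ ^ 2 / ε := by
    rw [← sub_nonneg]
    have : ε / 4 * h ^ 2 + D₁ ^ 2 / ε - h * D₁ = ε * (h / 2 - D₁ / ε) ^ 2 := by
      field_simp; ring
    rw [this]; positivity
  have y4 : 4 * l * (n * (D₂ / ε)) ≤ n ^ 2 / ε + 4 * l ^ 2 * D₂ ^ 2 / ε := by
    rw [← sub_nonneg]
    have : n ^ 2 / ε + 4 * l ^ 2 * D₂ ^ 2 / ε - 4 * l * (n * (D₂ / ε))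
        = (n - 2 * l * D₂) ^ 2 / ε := by
      field_simp; ring
    rw [this]; positivity
  have y5 : B * l⁻¹ ^ 2 * (2 * (a * h)) ≤ ε * h ^ 2 + (B * l⁻¹ ^ 2) ^ 2 * a ^ 2 / ε := by
    rw [← sub_nonneg]
    have : ε * h ^ 2 + (B * l⁻¹ ^ 2) ^ 2 * a ^ 2 / ε - B * l⁻¹ ^ 2 * (2 * (a * h))
        = ε * (h - B * l⁻¹ ^ 2 * a / ε) ^ 2 := by
      field_simp; ring
    rw [this]; positivity
  have y6 : 4 * l * (c / ε * n ^ 2) = 2 * (n ^ 2 / ε) := by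
    calc 4 * l * (c / ε * n ^ 2) = 4 * (l * c) * (n ^ 2 / ε) := by ring
      _ = 2 * (n ^ 2 / ε) := by rw [hlc]; norm_num
  have y7 : B * (M ^ 2 + l⁻¹ ^ 2 * q ^ 2)
      ≤ B * (M ^ 2 + l⁻¹ ^ 2 * (L⁻¹ * a ^ 2)) + B * l⁻¹ ^ 2 * (2 * (a * h)) := by
    have : B * l⁻¹ ^ 2 * q ^ 2 ≤ B * l⁻¹ ^ 2 * (L⁻¹ * a ^ 2 + 2 * (a * h)) := by gcongr
    linarith
  have y8 : ∀ x : ℝ, 0 ≤ x → x ≤ x / ε := fun x hx => by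
    rw [le_div_iff₀ hε]; exact mul_le_of_le_one_right hx hε1
  have y9 := y8 (B * (M ^ 2 + l⁻¹ ^ 2 * (L⁻¹ * a ^ 2))) (by positivity)
  have y10 : U ^ 2 * a ^ 2 / ε + D₁ ^ 2 / ε + 4 * l ^ 2 * D₂ ^ 2 / ε
      + B * (M ^ 2 + l⁻¹ ^ 2 * (L⁻¹ * a ^ 2)) / ε + (B * l⁻¹ ^ 2) ^ 2 * a ^ 2 / ε
      ≤ (U ^ 2 + D₁ ^ 2 + 4 * l ^ 2 * D₂ ^ 2 + B * (M ^ 2 + l⁻¹ ^ 2 * L⁻¹)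
        + (B * l⁻¹ ^ 2) ^ 2) / ε * (1 + a ^ 2) := by
    rw [← add_div, ← add_div, ← add_div, ← add_div, div_mul_eq_mul_div]
    refine div_le_div_of_nonneg_right ?_ hε.le
    have p1 : 0 ≤ U ^ 2 := by positivity
    have p2 : 0 ≤ (D₁ ^ 2 + 4 * l ^ 2 * D₂ ^ 2 + B * M ^ 2) * a ^ 2 := by positivity
    have p3 : 0 ≤ B * (l⁻¹ ^ 2 * L⁻¹) := by positivity
    have p4 : 0 ≤ (B * l⁻¹ ^ 2) ^ 2 := by positivity
    linarith
  have y11 : 0 ≤ ε * h ^ 2 := by positivity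
  linarith

/-- Dissipation at a fixed time of `‖rx‖² + K ‖σ‖²`, where `σ = sx + (c / ε) r`, `c = (2 l)⁻¹`. The
combination `σ` satisfies a damped transport equation whose boundary value is controlled by the
trace of `rx`. -/
theorem deriv_dissipation (hL : 0 < L) {U l : ℝ} (hl : 0 < l) (hU : 0 < U) {M : ℝ} (hM : 0 ≤ M)
    (C₀ C₁ C₃ : ℝ) :
    ∃ C, 0 ≤ C ∧ ∀ (ε β p q : ℝ) (rx rxx sx sxx F k' rt σ σx σt : L2 L), 0 < ε → ε ≤ 1 →
      ⟪one L, rx⟫ = 0 → rx = q • one L + J hL.le rxx → sx = p • one L + J hL.le sxx →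
      U * p + l⁻¹ * q = β → |β| ≤ M → ‖J hL.le rx‖ ≤ C₀ * ε → ‖F‖ ≤ C₃ → ‖k'‖ ≤ C₁ / ε →
      rt = -(U • rx) - sx + (2 * ε) • rxx + F →
      σ = sx + ((2 * l)⁻¹ / ε) • J hL.le rx → σx = sxx + ((2 * l)⁻¹ / ε) • rx →
      σt = β • k' - U • σx - ((2 * l)⁻¹ / ε) • σ
        + ((2 * l)⁻¹ / ε) ^ 2 • J hL.le rx + ((2 * l)⁻¹ / ε) • F →
      -⟪rxx, rt⟫ + 4 * l * ⟪σ, σt⟫ ≤ C / ε * (1 + ‖rx‖ ^ 2) := by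
  set c := (2 * l)⁻¹ with hc
  have hc0 : 0 < c := by positivity
  have hlc : l * c = 1 / 2 := by rw [hc]; field_simp
  set D₁ := c * C₀ + C₃ with hD₁
  set D₂ := M * C₁ + c ^ 2 * C₀ + c * C₃ with hD₂
  set B := 4 * l / U with hB
  have hB0 : 0 < B := by positivity
  refine ⟨U ^ 2 + D₁ ^ 2 + 4 * l ^ 2 * D₂ ^ 2 + B * (M ^ 2 + l⁻¹ ^ 2 * L⁻¹) + (B * l⁻¹ ^ 2) ^ 2,
    by positivity, ?_⟩
  intro ε β p q rx rxx sx sxx F k' rt σ σx σt hε hε1 h1 hrx hsx htr hβ hr hF hk' hrt hσ hσx hσt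
  set γ := c / ε with hγ
  have hγ0 : 0 < γ := by positivity
  set r := J hL.le rx with hrdef
  have hσ1 : σ = p • one L + J hL.le σx := by
    rw [hσ, hσx, map_add, map_smul, ← add_assoc, ← hsx]
  have e1 : -(1 / 2) * p ^ 2 ≤ ⟪σ, σx⟫ := by
    have h := inner_smul_one_add_J hL.le p p σx σx
    rw [← hσ1, real_inner_comm σ σx] at h
    linarith [mul_self_nonneg (p + ⟪one L, σx⟫)]
  have e2 : q ^ 2 ≤ L⁻¹ * ‖rx‖ ^ 2 + 2 * (‖rx‖ * ‖rxx‖) := by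
    have h := sq_trace_le hL q rxx
    rwa [← hrx] at h
  have hrxsx : sx = σ - γ • r := by rw [hσ]; abel
  have hγr : γ * ‖r‖ ≤ c * C₀ := by
    calc γ * ‖r‖ ≤ γ * (C₀ * ε) := by gcongr
      _ = c * C₀ := by rw [hγ]; field_simp
  -- the parabolic part
  have e3 : -⟪rxx, rt⟫ ≤ -2 * ε * ‖rxx‖ ^ 2 + ‖rxx‖ * (U * ‖rx‖ + ‖σ‖ + D₁) := by
    have h : -⟪rxx, rt⟫ = -2 * ε * ‖rxx‖ ^ 2 + ⟪rxx, U • rx + σ - γ • r - F⟫ := by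
      rw [hrt, hrxsx]
      simp only [inner_add_right, inner_sub_right, inner_neg_right, real_inner_smul_right,
        real_inner_self_eq_norm_sq]
      ring
    rw [h]
    have h2 : ‖U • rx + σ - γ • r - F‖ ≤ U * ‖rx‖ + ‖σ‖ + D₁ := by
      calc ‖U • rx + σ - γ • r - F‖ ≤ ‖U • rx‖ + ‖σ‖ + ‖γ • r‖ + ‖F‖ :=
            (norm_sub_le _ _).trans (add_le_add_left ((norm_sub_le _ _).trans
              (add_le_add_left (norm_add_le _ _) _)) _)
        _ = U * ‖rx‖ + ‖σ‖ + γ * ‖r‖ + ‖F‖ := by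
            rw [norm_smul, norm_smul, Real.norm_of_nonneg hU.le, Real.norm_of_nonneg hγ0.le]
        _ ≤ U * ‖rx‖ + ‖σ‖ + D₁ := by rw [hD₁]; linarith
    have h3 := (real_inner_le_norm rxx _).trans (mul_le_mul_of_nonneg_left h2 (norm_nonneg rxx))
    linarith
  -- the damped transport part
  have e4 : ⟪σ, σt⟫ ≤ U / 2 * p ^ 2 - γ * ‖σ‖ ^ 2 + ‖σ‖ * (D₂ / ε) := by
    have h : ⟪σ, σt⟫ = -U * ⟪σ, σx⟫ - γ * ‖σ‖ ^ 2 + ⟪σ, β • k' + γ ^ 2 • r + γ • F⟫ := by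
      rw [hσt]
      simp only [inner_add_right, inner_sub_right, real_inner_smul_right,
        real_inner_self_eq_norm_sq]
      ring
    rw [h]
    have h2 : ‖β • k' + γ ^ 2 • r + γ • F‖ ≤ D₂ / ε := by
      calc ‖β • k' + γ ^ 2 • r + γ • F‖ ≤ ‖β • k'‖ + ‖γ ^ 2 • r‖ + ‖γ • F‖ := norm_add₃_le
        _ = |β| * ‖k'‖ + γ * (γ * ‖r‖) + γ * ‖F‖ := by
            rw [norm_smul, norm_smul, norm_smul, Real.norm_of_nonneg hγ0.le,
              Real.norm_of_nonneg (sq_nonneg γ), Real.norm_eq_abs]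
            ring
        _ ≤ M * (C₁ / ε) + γ * (c * C₀) + γ * C₃ := by gcongr
        _ = D₂ / ε := by rw [hD₂, hγ]; field_simp
    have h3 := (real_inner_le_norm σ _).trans (mul_le_mul_of_nonneg_left h2 (norm_nonneg σ))
    have h4 := mul_le_mul_of_nonneg_left e1 hU.le
    linarith
  -- the inflow value `p` of `σ`, through the relation `U p + l⁻¹ q = β`
  have e5 : 4 * l * (U / 2 * p ^ 2) ≤ B * (M ^ 2 + l⁻¹ ^ 2 * q ^ 2) := by
    have hp : U * p = β - l⁻¹ * q := by linarith
    have h2 : (U * p) ^ 2 ≤ 2 * (M ^ 2 + l⁻¹ ^ 2 * q ^ 2) := by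
      have h3 : β ^ 2 ≤ M ^ 2 := sq_le_sq' (neg_le_of_abs_le hβ) (le_of_abs_le hβ)
      rw [hp]
      linarith [sq_nonneg (β + l⁻¹ * q)]
    have h3 : 4 * l * (U / 2 * p ^ 2) = B / 2 * (U * p) ^ 2 := by rw [hB]; field_simp
    rw [h3]
    have h4 := mul_le_mul_of_nonneg_left h2 (half_pos hB0).le
    linarith
  set a := ‖rx‖
  set h := ‖rxx‖
  set n := ‖σ‖
  have ha0 : 0 ≤ a := norm_nonneg _
  have key := dissipation_real (U := U) (D₁ := D₁) (D₂ := D₂) (M := M) (n := n) hε hε1 hlc hB0 hl hL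
    e2
  have e4' := mul_le_mul_of_nonneg_left e4 (by positivity : 0 ≤ 4 * l)
  linarith

end Estimates

/-! ### Estimates for the error system -/

section ErrorSystem

variable {L : ℝ}

/-- The system solved by the difference `(r, s)` of the viscous solution, of the limit solution and
of the boundary layer corrector. The subscripts `x`, `t` in the names of the paths stand for
derivatives, `l` for `λ²`; the forcing consists of `ε Φ` and of the boundary layer functions `k`,
`e` with coefficients `y`, `z`, `β` that depend on time, and `k'` is the derivative of `k`. All
initial data vanish, and so do `r(0)`, `r(L)`, `s(0)`. The relation between `p = sx(0)` and
`q = rx(0)` is the equation for `s` at `x = 0`, and `eq_sx` is its derivative in space. -/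
structure IsErrorSystem (hL : 0 < L) (T U l α M ε : ℝ) (k k' e : L2 L) (β y z : ℝ → ℝ)
    (r rx rxx rt s sx sxx st sxt Φ : ℝ → L2 L) : Prop where
  path_r : IsPath T r rt 0
  path_s : IsPath T s st 0
  path_sx : IsPath T sx sxt 0
  memLp_rx : MemLp rx ∞ (volume.restrict (Ioo 0 T))
  memLp_rxx : MemLp rxx ∞ (volume.restrict (Ioo 0 T))
  abs_k_le : ∀ᵐ x ∂(volume.restrict (Ioo 0 L)), |k x| ≤ expW (α / ε) x
  abs_e_le : ∀ᵐ x ∂(volume.restrict (Ioo 0 L)), |e x| ≤ expW (α / ε) x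
  bounds : ∀ᵐ t ∂(volume.restrict (Ioo 0 T)), ‖Φ t‖ ≤ M ∧ |y t| ≤ M ∧ |z t| ≤ M ∧ |β t| ≤ M
  space_r : ∀ᵐ t ∂(volume.restrict (Ioo 0 T)), r t = J hL.le (rx t) ∧ ⟪one L, rx t⟫ = 0
  space_s : ∀ᵐ t ∂(volume.restrict (Ioo 0 T)), s t = J hL.le (sx t)
  space_x : ∀ᵐ t ∂(volume.restrict (Ioo 0 T)), ∃ p q : ℝ, rx t = q • one L + J hL.le (rxx t) ∧
    sx t = p • one L + J hL.le (sxx t) ∧ U * p + l⁻¹ * q = β t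
  eq_r : ∀ᵐ t ∂(volume.restrict (Ioo 0 T)), rt t = -(U • rx t) - sx t + (2 * ε) • rxx t
    + (ε • Φ t + y t • k + z t • e)
  eq_s : ∀ᵐ t ∂(volume.restrict (Ioo 0 T)), st t = -(U • sx t) - l⁻¹ • rx t + β t • k
  eq_sx : ∀ᵐ t ∂(volume.restrict (Ioo 0 T)),
    sxt t = β t • k' - U • sxx t - l⁻¹ • rxx t

theorem integrableOn_inner {T : ℝ} {v w : ℝ → L2 L} (hv : MemLp v ∞ (volume.restrict (Ioo 0 T)))
    (hw : MemLp w ∞ (volume.restrict (Ioo 0 T))) :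
    IntegrableOn (fun t => ⟪v t, w t⟫) (Ioo 0 T) := by
  obtain ⟨K, hK0, hK⟩ := exists_bound_of_memLp_top hv
  obtain ⟨M, hM0, hM⟩ := exists_bound_of_memLp_top hw
  refine Integrable.of_bound (C := K * M) (hv.1.inner hw.1) ?_
  filter_upwards [hK, hM] with t h1 h2
  exact (norm_inner_le_norm _ _).trans (mul_le_mul h1 h2 (norm_nonneg _) hK0)

theorem integrableOn_norm_sq {T : ℝ} {v : ℝ → L2 L}
    (hv : MemLp v ∞ (volume.restrict (Ioo 0 T))) :
    IntegrableOn (fun t => ‖v t‖ ^ 2) (Ioo 0 T) := by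
  simpa only [real_inner_self_eq_norm_sq] using integrableOn_inner hv hv

theorem integral_mono_of_ae_Ioo {T t : ℝ} (ht : t ∈ Ioo 0 T) {f g : ℝ → ℝ}
    (hf : IntegrableOn f (Ioo 0 T)) (hg : IntegrableOn g (Ioo 0 T))
    (h : ∀ᵐ s ∂(volume.restrict (Ioo 0 T)), f s ≤ g s) :
    ∫ s in (0 : ℝ)..t, f s ≤ ∫ s in (0 : ℝ)..t, g s := by
  have h0 : (0 : ℝ) ∈ Icc 0 T := left_mem_Icc.2 (ht.1.trans ht.2).le
  refine intervalIntegral.integral_mono_ae_restrict ht.1.le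
    (intervalIntegrable_of_integrableOn hf h0 (Ioo_subset_Icc_self ht))
    (intervalIntegrable_of_integrableOn hg h0 (Ioo_subset_Icc_self ht)) ?_
  rw [← Measure.restrict_congr_set (Ioo_ae_eq_Icc (a := (0 : ℝ)) (b := t))]
  exact ae_restrict_of_ae_restrict_of_subset (Ioo_subset_Ioo_right ht.2.le) h

/-- If the essential supremum `m` of `‖v‖` satisfies `m² ≤ ε A m + ε² B`, then it is `O(ε)`. -/
theorem ae_norm_le_of_forall_sq_le {T ε A B : ℝ} (hε : 0 < ε) (hA : 0 ≤ A) (hB : 0 ≤ B)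
    {v : ℝ → L2 L} (hv : MemLp v ∞ (volume.restrict (Ioo 0 T)))
    (h : ∀ m, 0 ≤ m → (∀ᵐ t ∂(volume.restrict (Ioo 0 T)), ‖v t‖ ≤ m) →
      ∀ᵐ t ∂(volume.restrict (Ioo 0 T)), ‖v t‖ ^ 2 ≤ ε * A * m + ε ^ 2 * B) :
    ∀ᵐ t ∂(volume.restrict (Ioo 0 T)), ‖v t‖ ≤ ε * (A + B + 1) := by
  set m := (eLpNorm v ∞ (volume.restrict (Ioo 0 T))).toReal with hm
  have hm0 : 0 ≤ m := ENNReal.toReal_nonneg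
  have h1 : ∀ᵐ t ∂(volume.restrict (Ioo 0 T)), ‖v t‖ ≤ m := by
    filter_upwards [ae_le_eLpNormEssSup (f := v) (μ := volume.restrict (Ioo 0 T))] with t ht
    rw [← eLpNorm_exponent_top] at ht
    rw [← toReal_enorm]
    exact ENNReal.toReal_mono hv.2.ne ht
  have h2 := h m hm0 h1
  have hX : 0 ≤ ε * A * m + ε ^ 2 * B := by positivity
  have h3 : m ≤ √(ε * A * m + ε ^ 2 * B) := by
    rw [hm, eLpNorm_exponent_top]
    refine ENNReal.toReal_le_of_le_ofReal (Real.sqrt_nonneg _) ?_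
    refine eLpNormEssSup_le_of_ae_bound ?_
    filter_upwards [h2] with t ht
    exact Real.le_sqrt_of_sq_le ht
  have h4 : m ^ 2 ≤ ε * A * m + ε ^ 2 * B := by
    calc m ^ 2 ≤ √(ε * A * m + ε ^ 2 * B) ^ 2 := by gcongr
      _ = _ := Real.sq_sqrt hX
  have h5 : m ≤ ε * (A + B + 1) := by
    by_contra! hcon
    have h6 : 0 < m := lt_of_le_of_lt (by positivity) hcon
    have h7 : ε * (A + B + 1) * m < m ^ 2 := by rw [pow_two]; gcongr
    have h8 : ε ≤ m := by
      have : ε * 1 ≤ ε * (A + B + 1) := by gcongr; linarith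
      linarith
    have h9 : ε ^ 2 * B ≤ ε * B * m := by
      have : ε * B * ε ≤ ε * B * m := by gcongr
      linarith
    have h10 : 0 < ε * m := by positivity
    linarith
  filter_upwards [h1] with t ht
  exact ht.trans h5

/-- The weighted energy estimate: the error is `O(ε)` in `L²`, uniformly in time. -/
theorem IsErrorSystem.energy (hL : 0 < L) {T U l α M : ℝ} (hT : 0 < T) (hl : 0 < l) (hU : 0 < U)
    (hα : 0 < α) (hM : 0 < M) (hK1 : l * U * α ≤ 1) :
    ∃ C, 0 ≤ C ∧ ∀ (ε : ℝ) (k k' e : L2 L) (β y z : ℝ → ℝ)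
      (r rx rxx rt s sx sxx st sxt Φ : ℝ → L2 L), 0 < ε →
      IsErrorSystem hL T U l α M ε k k' e β y z r rx rxx rt s sx sxx st sxt Φ →
      ∀ᵐ t ∂(volume.restrict (Ioo 0 T)), ‖r t‖ ≤ C * ε ∧ ‖s t‖ ≤ C * ε ∧
        ∫ τ in (0 : ℝ)..t, ‖rx τ‖ ^ 2 ≤ C * ε := by
  set K := l * U * α with hK
  set C₁ := 8 * M ^ 2 / α ^ 3 + 4 * l ^ 2 * M ^ 2 / (α * K ^ 2) with hC₁
  have hC₁0 : 0 ≤ C₁ := by positivity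
  have hK0 : 0 < K := by positivity
  set G := 2 * M * T + 2 * C₁ * T + 1 with hG
  have hG0 : 0 < G := by positivity
  set X := (2 * M * G + 2 * C₁) * T with hX
  have hX0 : 0 ≤ X := by positivity
  refine ⟨G + √(X / l) + X, by positivity, ?_⟩
  intro ε k k' e β y z r rx rxx rt s sx sxx st sxt Φ hε H
  have ha : 0 ≤ α / ε := by positivity
  have hr := H.path_r.memLp_top
  have hs := H.path_s.memLp_top
  -- the positive symmetric operator of the weighted energy of `s`
  set B : L2 L →L[ℝ] L2 L := l • (ContinuousLinearMap.id ℝ (L2 L) + K • mulExpW L ha) with hB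
  have hBapp : ∀ v, B v = l • (v + K • mulExpW L ha v) := fun v => by simp [hB]
  have hBs := memLp_top_clm B hs
  have hBsymm : ∀ v w, ⟪B v, w⟫ = ⟪B w, v⟫ := fun v w => by
    rw [hBapp, hBapp]
    simp only [real_inner_smul_left, inner_add_left]
    rw [real_inner_comm, inner_mulExpW_comm hL.le ha v w]
  have hBpos : ∀ v, l * ‖v‖ ^ 2 ≤ ⟪B v, v⟫ := fun v => by
    rw [hBapp]
    simp only [real_inner_smul_left, inner_add_left, real_inner_self_eq_norm_sq]
    have := mul_nonneg hK0.le (inner_mulExpW_nonneg hL.le ha v)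
    have := mul_nonneg hl.le this
    linarith
  have E1 := H.path_r.inner_le_integral hr (fun _ => True) (by simp)
    (fun s t _ _ => real_inner_comm _ _) (fun s t _ _ => real_inner_self_nonneg)
  have E2 := H.path_s.inner_le_integral hBs (fun _ => True) (by simp)
    (fun s t _ _ => hBsymm _ _) (fun s t _ _ => by
      rw [← map_sub]; exact le_trans (by positivity) (hBpos _))
  have hdiss : ∀ᵐ t ∂(volume.restrict (Ioo 0 T)), 2 * ⟪r t, rt t⟫ + 2 * ⟪B (s t), st t⟫
      ≤ -ε * ‖rx t‖ ^ 2 + (2 * ε * M * ‖r t‖ + 2 * C₁ * ε ^ 2) := by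
    filter_upwards [H.bounds, H.space_r, H.space_s, H.space_x, H.eq_r, H.eq_s] with t h1 h2 h3 h4
      h5 h6
    obtain ⟨p, q, h7, -, -⟩ := h4
    have h := energy_dissipation hL hl hU hα hε hM hK hK1 h2.2 h7 h1.1 h1.2.1 h1.2.2.1 h1.2.2.2
      H.abs_k_le H.abs_e_le ha h5 h6
    rw [← h2.1, ← h3, ← hC₁] at h
    rw [hBapp, real_inner_smul_left]
    linarith
  have hi1 := (integrableOn_inner hr H.path_r.1).const_mul 2
  have hi2 := (integrableOn_inner hBs H.path_s.1).const_mul 2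
  have hi3 := (integrableOn_norm_sq H.memLp_rx).const_mul (-ε)
  have hmain : ∀ m, 0 ≤ m → (∀ᵐ t ∂(volume.restrict (Ioo 0 T)), ‖r t‖ ≤ m) →
      ∀ᵐ t ∂(volume.restrict (Ioo 0 T)), ‖r t‖ ^ 2 + l * ‖s t‖ ^ 2
        + ε * ∫ τ in (0 : ℝ)..t, ‖rx τ‖ ^ 2 ≤ (2 * ε * M * m + 2 * C₁ * ε ^ 2) * T := by
    intro m hm0 hm
    filter_upwards [E1, E2, ae_restrict_mem measurableSet_Ioo] with t e1 e2 ht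
    have h0 : (0 : ℝ) ∈ Icc 0 T := left_mem_Icc.2 hT.le
    have ht' := Ioo_subset_Icc_self ht
    have hc : IntegrableOn (fun _ : ℝ => 2 * ε * M * m + 2 * C₁ * ε ^ 2) (Ioo 0 T) :=
      integrableOn_const (by simp)
    have key := integral_mono_of_ae_Ioo ht (hi1.add hi2) (hi3.add hc) (by
      filter_upwards [hdiss, hm] with τ h1 h2
      simp only [Pi.add_apply]
      refine h1.trans ?_
      have : 2 * ε * M * ‖r τ‖ ≤ 2 * ε * M * m := by gcongr
      linarith)
    simp only [Pi.add_apply] at key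
    rw [intervalIntegral.integral_add (intervalIntegrable_of_integrableOn hi1 h0 ht')
      (intervalIntegrable_of_integrableOn hi2 h0 ht'),
      intervalIntegral.integral_add (intervalIntegrable_of_integrableOn hi3 h0 ht')
      (intervalIntegrable_of_integrableOn hc h0 ht'),
      intervalIntegral.integral_const, intervalIntegral.integral_const_mul (-ε), smul_eq_mul,
      sub_zero] at key
    rw [real_inner_self_eq_norm_sq] at e1
    have e3 := hBpos (s t)
    have e4 : t * (2 * ε * M * m + 2 * C₁ * ε ^ 2) ≤ T * (2 * ε * M * m + 2 * C₁ * ε ^ 2) := by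
      gcongr; exact ht.2.le
    linarith
  have hint0 : ∀ t ∈ Ioo 0 T, 0 ≤ ∫ τ in (0 : ℝ)..t, ‖rx τ‖ ^ 2 := fun t ht =>
    intervalIntegral.integral_nonneg ht.1.le fun _ _ => by positivity
  -- the term `2 ε M ‖r‖` is absorbed through the essential supremum of `‖r‖`
  have hm := ae_norm_le_of_forall_sq_le (A := 2 * M * T) (B := 2 * C₁ * T) hε (by positivity)
    (by positivity) hr (fun m hm0 hm => by
      filter_upwards [hmain m hm0 hm, ae_restrict_mem measurableSet_Ioo] with t h1 ht
      have h2 := mul_nonneg hε.le (hint0 t ht)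
      have h3 : 0 ≤ l * ‖s t‖ ^ 2 := by positivity
      linarith)
  filter_upwards [hm, hmain _ (by positivity) hm, ae_restrict_mem measurableSet_Ioo] with t h1 h2 ht
  have h3 := mul_nonneg hε.le (hint0 t ht)
  have h4 : (2 * ε * M * (ε * G) + 2 * C₁ * ε ^ 2) * T = X * ε ^ 2 := by rw [hX]; ring
  rw [← hG, h4] at h2
  have h5 : 0 ≤ √(X / l) := Real.sqrt_nonneg _
  refine ⟨?_, ?_, ?_⟩
  · have h6 : 0 ≤ (√(X / l) + X) * ε := by positivity
    linarith
  · have h6 : ‖s t‖ ^ 2 ≤ X / l * ε ^ 2 := by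
      rw [div_mul_eq_mul_div, le_div_iff₀ hl]
      linarith [sq_nonneg ‖r t‖]
    have h7 : ‖s t‖ ≤ √(X / l) * ε := by
      refine abs_le_of_sq_le_sq' ?_ (by positivity) |>.2
      rw [mul_pow, Real.sq_sqrt (by positivity)]
      exact h6
    have h8 : 0 ≤ (G + X) * ε := by positivity
    linarith
  · have h6 : ε * ∫ τ in (0 : ℝ)..t, ‖rx τ‖ ^ 2 ≤ ε * (X * ε) := by
      have : 0 ≤ l * ‖s t‖ ^ 2 := by positivity
      linarith [sq_nonneg ‖r t‖]
    have h7 := le_of_mul_le_mul_left h6 hε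
    have h8 : 0 ≤ (G + √(X / l)) * ε := by positivity
    linarith

/-- The bound `O(ε ^ (-1/2))` in `L²` for the space derivatives of the error. -/
theorem IsErrorSystem.deriv_bound (hL : 0 < L) {T U l α M : ℝ} (hT : 0 < T) (hl : 0 < l)
    (hU : 0 < U) (hα : 0 < α) (hM : 0 < M) (hK1 : l * U * α ≤ 1) (C₁ : ℝ) :
    ∃ C, 0 ≤ C ∧ ∀ (ε : ℝ) (k k' e : L2 L) (β y z : ℝ → ℝ)
      (r rx rxx rt s sx sxx st sxt Φ : ℝ → L2 L), 0 < ε → ε ≤ 1 → ‖k'‖ ≤ C₁ / ε →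
      IsErrorSystem hL T U l α M ε k k' e β y z r rx rxx rt s sx sxx st sxt Φ →
      ∀ᵐ t ∂(volume.restrict (Ioo 0 T)), ‖r t‖ ≤ C * ε ∧ ‖s t‖ ≤ C * ε ∧
        ‖rx t‖ ^ 2 ≤ C / ε ∧ ‖sx t‖ ^ 2 ≤ C / ε := by
  obtain ⟨C₀, hC₀, hen⟩ := IsErrorSystem.energy hL hT hl hU hα hM hK1
  set ν : ℝ := (measureUnivNNReal (volume.restrict (Ioo (0 : ℝ) L)) : ℝ) ^ (2 : ℝ≥0∞).toReal⁻¹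
    with hν
  have hν0 : 0 ≤ ν := by positivity
  set C₃ := M + M * ν + M * ν with hC₃
  obtain ⟨C₂, hC₂, hdiss⟩ := deriv_dissipation hL hl hU hM.le C₀ C₁ C₃
  set c := (2 * l)⁻¹ with hc
  have hc0 : 0 < c := by positivity
  set X := 2 * C₂ * (T + C₀) with hX
  have hX0 : 0 ≤ X := by positivity
  refine ⟨C₀ + X + (2 * (X / (4 * l)) + 2 * (c * C₀) ^ 2), by positivity, ?_⟩
  intro ε k k' e β y z r rx rxx rt s sx sxx st sxt Φ hε hε1 hk' H
  have hE := hen ε k k' e β y z r rx rxx rt s sx sxx st sxt Φ hε H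
  have ha : 0 ≤ α / ε := by positivity
  set γ := c / ε with hγ
  have hγ0 : 0 < γ := by positivity
  set σ : ℝ → L2 L := fun t => sx t + γ • r t with hσ
  set σt : ℝ → L2 L := fun t => sxt t + γ • rt t with hσt
  have hσpath : IsPath T σ σt 0 := by
    have := H.path_sx.add (H.path_r.map (γ • ContinuousLinearMap.id ℝ (L2 L)))
    simpa using this
  have hr := H.path_r.memLp_top
  have hσm := hσpath.memLp_top
  have hnrxx : MemLp (fun t => -rxx t) ∞ (volume.restrict (Ioo 0 T)) := H.memLp_rxx.neg
  -- `-∂ₓ²` with homogeneous Dirichlet conditions is symmetric and monotone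
  let P : ℝ → Prop := fun t => (r t = J hL.le (rx t) ∧ ⟪one L, rx t⟫ = 0) ∧
    ∃ q : ℝ, rx t = q • one L + J hL.le (rxx t)
  have hP : ∀ᵐ t ∂(volume.restrict (Ioo 0 T)), P t := by
    filter_upwards [H.space_r, H.space_x] with t h1 h2
    obtain ⟨p, q, h3, -⟩ := h2
    exact ⟨h1, q, h3⟩
  have hPinner : ∀ t t', P t → P t' → ⟪rxx t, r t'⟫ = -⟪rx t, rx t'⟫ := by
    rintro t t' ⟨-, q, hq⟩ ⟨⟨h1, h2⟩, -⟩
    have h := inner_smul_one_add_J hL.le 0 q (rx t') (rxx t)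
    rw [← hq, h2, zero_smul, zero_add, ← h1] at h
    rw [real_inner_comm (r t') (rxx t), real_inner_comm (rx t') (rx t)]
    linarith
  have E1 := H.path_r.inner_le_integral hnrxx P hP
    (fun s t hs ht => by
      rw [inner_neg_left, inner_neg_left, hPinner t s ht hs, hPinner s t hs ht, real_inner_comm])
    (fun s t hs ht => by
      have : ⟪-rxx t - -rxx s, r t - r s⟫ = ⟪rx t - rx s, rx t - rx s⟫ := by
        simp only [inner_sub_left, inner_sub_right, inner_neg_left]
        rw [hPinner t s ht hs, hPinner s t hs ht, hPinner t t ht ht, hPinner s s hs hs]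
        ring
      rw [this]
      exact real_inner_self_nonneg)
  have E2 := hσpath.inner_le_integral hσm (fun _ => True) (by simp)
    (fun s t _ _ => real_inner_comm _ _) (fun s t _ _ => real_inner_self_nonneg)
  have hdiss' : ∀ᵐ t ∂(volume.restrict (Ioo 0 T)),
      2 * ⟪-rxx t, rt t⟫ + 4 * l * (2 * ⟪σ t, σt t⟫)
        ≤ 2 * C₂ / ε + 2 * C₂ / ε * ‖rx t‖ ^ 2 := by
    filter_upwards [H.bounds, H.space_r, H.space_x, H.eq_r, H.eq_sx, hE] with t h1 h2 h3 h4 h5 h6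
    obtain ⟨p, q, h7, h8, h9⟩ := h3
    have hle1 : ∀ v : L2 L, (∀ᵐ x ∂(volume.restrict (Ioo 0 L)), |v x| ≤ expW (α / ε) x) →
        ‖v‖ ≤ ν := fun v hv => by
      have := norm_le_of_ae_abs_le (v := v) zero_le_one (by
        filter_upwards [hv, ae_restrict_mem measurableSet_Ioo] with x hx hx'
        exact hx.trans (expW_le_one ha hx'.1.le))
      rwa [mul_one] at this
    have hF : ‖ε • Φ t + y t • k + z t • e‖ ≤ C₃ := by
      calc ‖ε • Φ t + y t • k + z t • e‖ ≤ ‖ε • Φ t‖ + ‖y t • k‖ + ‖z t • e‖ := norm_add₃_le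
        _ = ε * ‖Φ t‖ + |y t| * ‖k‖ + |z t| * ‖e‖ := by
            rw [norm_smul, norm_smul, norm_smul, Real.norm_of_nonneg hε.le, Real.norm_eq_abs,
              Real.norm_eq_abs]
        _ ≤ 1 * M + M * ν + M * ν := by
            have e1 := hle1 k H.abs_k_le
            have e2 := hle1 e H.abs_e_le
            have e3 := h1.1
            have e4 := h1.2.1
            have e5 := h1.2.2.1
            gcongr
        _ = C₃ := by rw [hC₃, one_mul]
    have h := hdiss ε (β t) p q (rx t) (rxx t) (sx t) (sxx t) (ε • Φ t + y t • k + z t • e) k'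
      (rt t) (σ t) (sxx t + γ • rx t) (σt t) hε hε1 h2.2 h7 h8 h9 h1.2.2.2
      (by rw [← h2.1]; exact h6.1) hF hk' h4 (by rw [← h2.1]) rfl (by
        rw [← h2.1]
        simp only [hσ, hσt, ← hγ]
        rw [h5, h4]
        -- `γ` times the equation for `r` cancels `rxx` in the equation for `sx`
        have h10 : l⁻¹ = γ * (2 * ε) := by rw [hγ, hc]; field_simp
        rw [h10]
        module)
    rw [inner_neg_left]
    have h11 : C₂ / ε * (1 + ‖rx t‖ ^ 2) * 2 = 2 * C₂ / ε + 2 * C₂ / ε * ‖rx t‖ ^ 2 := by ring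
    rw [← h11]
    linarith
  have hi1 := (integrableOn_inner hnrxx H.path_r.1).const_mul 2
  have hi2 := ((integrableOn_inner hσm hσpath.1).const_mul 2).const_mul (4 * l)
  have hi3 := (integrableOn_norm_sq H.memLp_rx).const_mul (2 * C₂ / ε)
  have hc3 : IntegrableOn (fun _ : ℝ => 2 * C₂ / ε) (Ioo 0 T) := integrableOn_const (by simp)
  filter_upwards [E1, E2, hE, hP, ae_restrict_mem measurableSet_Ioo] with t e1 e2 e3 e4 ht
  have h0 : (0 : ℝ) ∈ Icc 0 T := left_mem_Icc.2 hT.le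
  have ht' := Ioo_subset_Icc_self ht
  have key := integral_mono_of_ae_Ioo ht (hi1.add hi2) (hc3.add hi3) (by
    filter_upwards [hdiss'] with τ h1
    simpa only [Pi.add_apply] using h1)
  simp only [Pi.add_apply] at key
  rw [intervalIntegral.integral_add (intervalIntegrable_of_integrableOn hi1 h0 ht')
    (intervalIntegrable_of_integrableOn hi2 h0 ht'),
    intervalIntegral.integral_add (intervalIntegrable_of_integrableOn hc3 h0 ht')
    (intervalIntegrable_of_integrableOn hi3 h0 ht'),
    intervalIntegral.integral_const, intervalIntegral.integral_const_mul (4 * l),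
    intervalIntegral.integral_const_mul (2 * C₂ / ε), smul_eq_mul, sub_zero] at key
  rw [inner_neg_left, hPinner t t e4 e4, neg_neg, real_inner_self_eq_norm_sq] at e1
  rw [real_inner_self_eq_norm_sq] at e2
  have hsum : ‖rx t‖ ^ 2 + 4 * l * ‖σ t‖ ^ 2 ≤ X / ε := by
    have h1 : t * (2 * C₂ / ε) ≤ T * (2 * C₂ / ε) := by gcongr; exact ht.2.le
    have h2 : 2 * C₂ / ε * (∫ τ in (0 : ℝ)..t, ‖rx τ‖ ^ 2) ≤ 2 * C₂ / ε * (C₀ * 1) := by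
      gcongr
      exact e3.2.2.trans (by gcongr)
    have h3 : T * (2 * C₂ / ε) + 2 * C₂ / ε * (C₀ * 1) = X / ε := by rw [hX]; ring
    have h4 := mul_le_mul_of_nonneg_left e2 (by positivity : 0 ≤ 4 * l)
    linarith
  have hσle : ‖σ t‖ ^ 2 ≤ X / (4 * l) / ε := by
    have h1 : ‖σ t‖ ^ 2 * (4 * l) ≤ X / ε := by linarith [sq_nonneg ‖rx t‖]
    rw [div_right_comm, le_div_iff₀ (by positivity)]
    exact h1
  have hsxle : ‖sx t‖ ^ 2 ≤ (2 * (X / (4 * l)) + 2 * (c * C₀) ^ 2) / ε := by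
    have h1 : sx t = σ t - γ • r t := by simp [hσ]
    have h2 : ‖sx t‖ ≤ ‖σ t‖ + c * C₀ := by
      rw [h1]
      refine (norm_sub_le _ _).trans ?_
      gcongr
      rw [norm_smul, Real.norm_of_nonneg hγ0.le]
      calc γ * ‖r t‖ ≤ γ * (C₀ * ε) := by gcongr; exact e3.1
        _ = c * C₀ := by rw [hγ]; field_simp
    have h3 : ‖sx t‖ ^ 2 ≤ (‖σ t‖ + c * C₀) ^ 2 := by gcongr
    have h4 : (c * C₀) ^ 2 ≤ (c * C₀) ^ 2 / ε := by
      rw [le_div_iff₀ hε]; exact mul_le_of_le_one_right (sq_nonneg _) hε1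
    have h5 : (2 * (X / (4 * l)) + 2 * (c * C₀) ^ 2) / ε
        = 2 * (X / (4 * l) / ε) + 2 * ((c * C₀) ^ 2 / ε) := by ring
    rw [h5]
    linarith [sq_nonneg (‖σ t‖ - c * C₀)]
  have hW0 : 0 ≤ 2 * (X / (4 * l)) + 2 * (c * C₀) ^ 2 := by positivity
  refine ⟨e3.1.trans ?_, e3.2.1.trans ?_, ?_, hsxle.trans ?_⟩
  · gcongr; linarith
  · gcongr; linarith
  · have h1 : ‖rx t‖ ^ 2 ≤ X / ε := by
      have : 0 ≤ 4 * l * ‖σ t‖ ^ 2 := by positivity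
      linarith
    refine h1.trans ?_
    gcongr; linarith
  · exact div_le_div_of_nonneg_right (by linarith) hε.le

end ErrorSystem

/-! ### Solutions in terms of the integration operator, and the corrector -/

section Data

variable {L T : ℝ}

/-- A function in `H¹(0, L)` is determined by its value at `0` and its derivative. -/
theorem HasWeakDeriv.exists_eq_smul_one_add_J (hL : 0 < L) {v w : L2 L}
    (h : HasWeakDeriv 0 L (v : ℝ → ℝ) (w : ℝ → ℝ)) : ∃ c : ℝ, v = c • one L + J hL.le w := by
  have hw : IntegrableOn (w : ℝ → ℝ) (Ioo 0 L) := by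
    rw [← intervalIntegrable_iff_integrableOn_Ioo_of_le hL.le]
    exact intervalIntegrable_coe hL.le w
  obtain ⟨c, hc⟩ := h.exists_ae_eq_primitive hL hw
  refine ⟨c, Lp.ext ?_⟩
  filter_upwards [hc, coeFn_smul_one_add_J hL.le c w] with x h1 h2
  rw [h1, h2, prim]

theorem HasValueAt.prim_eq (hL : 0 < L) {c a d : ℝ} {w : L2 L}
    (h : HasValueAt (c • one L + J hL.le w) a d) (ha : a ∈ Icc 0 L) : prim c w a = d := by
  obtain ⟨ρ, hρ, hρv, hρa⟩ := h
  have h1 : EqOn ρ (prim c w) (Icc 0 L) := by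
    refine Measure.eqOn_Icc_of_ae_eq volume hL.ne ?_ hρ (prim_continuousOn hL.le c w)
    rw [Measure.restrict_congr_set Ioo_ae_eq_Icc.symm]
    filter_upwards [hρv, coeFn_smul_one_add_J hL.le c w] with x h1 h2
    rw [← h1, h2]
  rw [← h1 ha, hρa]

theorem hasValueAt_zero (hL : 0 < L) (c : ℝ) (w : L2 L) :
    HasValueAt (c • one L + J hL.le w) 0 c :=
  ⟨prim c w, prim_continuousOn hL.le c w, coeFn_smul_one_add_J hL.le c w, prim_zero c w⟩

theorem IsDx.ae_eq {v w w' : ℝ → L2 L} (h : IsDx T v w) (h' : IsDx T v w') :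
    w =ᵐ[volume.restrict (Ioo 0 T)] w' := by
  filter_upwards [h, h'] with t h1 h2
  exact Lp.ext (h1.unique h2)

theorem IsDx.congr {v v' w : ℝ → L2 L} (h : IsDx T v w)
    (hv : v =ᵐ[volume.restrict (Ioo 0 T)] v') : IsDx T v' w := by
  filter_upwards [h, hv] with t h1 h2
  rwa [← h2]

theorem IsDt.isPath (hT : 0 < T) {v v' : ℝ → L2 L} (h : IsDt T v v') (hv : MemC T v)
    (hv' : MemC T v') : IsPath T v v' (v 0) := by
  obtain ⟨c, hc⟩ := HasWeakDeriv.exists_isPath hT h (memLp_top_of_continuousOn hv')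
  rwa [hc.eq_of_continuousOn hT hv] at hc

/-- The regularity and the equations of a solution of the viscous problem, with derivatives in
space expressed through the integration operator `J`. -/
theorem viscous_data (hL : 0 < L) (hT : 0 < T) {U lam ε : ℝ} {f g : ℝ → L2 L} {u₀ ψ₀ : L2 L}
    {u ψ : ℝ → L2 L} (hK : MemK T u ψ) (hS : SolvesViscous U lam T ε f g u₀ ψ₀ u ψ) :
    ∃ (ut ψt ux uxx ψx ψxx ψxt : ℝ → L2 L) (d : L2 L), IsPath T u ut u₀ ∧ IsPath T ψ ψt ψ₀ ∧
      IsPath T ψx ψxt d ∧ MemLp ux ∞ (volume.restrict (Ioo 0 T)) ∧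
      MemLp uxx ∞ (volume.restrict (Ioo 0 T)) ∧
      ∀ᵐ t ∂(volume.restrict (Ioo 0 T)), (u t = J hL.le (ux t) ∧ ⟪one L, ux t⟫ = 0) ∧
        ψ t = J hL.le (ψx t) ∧ (∃ q : ℝ, ux t = q • one L + J hL.le (uxx t)) ∧
        (∃ p : ℝ, ψx t = p • one L + J hL.le (ψxx t)) ∧
        ut t + U • ux t + ψx t - (2 * ε) • uxx t = f t ∧
        ψt t + U • ψx t + (lam⁻¹ ^ 2) • ux t = g t := by
  obtain ⟨hu, hψ, ⟨-, -, ⟨ux, uxx, -, hux, huxx, -, hux', huxx', -⟩, hbc⟩,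
    ⟨ψx, ψxt, ψxx, hψx, hψxt, hψxx, hψxt', -⟩, ut, ψt, hut, hψt, hut', hψt'⟩ := hK
  obtain ⟨⟨vt, φt, vx, φx, vxx, hvt, hφt, hvx, hφx, hvxx, heq⟩, -, h0, h0'⟩ := hS
  obtain ⟨d, hd⟩ := HasWeakDeriv.exists_isPath hT hψxt hψxt'
  refine ⟨ut, ψt, ux, uxx, ψx, ψxx, ψxt, d, h0 ▸ hut.isPath hT hu hut', h0' ▸ hψt.isPath hT hψ hψt',
    hd, hux', huxx', ?_⟩
  have e1 := hvx.ae_eq hux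
  filter_upwards [HasWeakDeriv.unique hvt hut, HasWeakDeriv.unique hφt hψt, e1, hφx.ae_eq hψx,
    (hvxx.congr e1).ae_eq huxx, heq, hbc, hux, huxx, hψx, hψxx]
    with t a1 a2 a3 a4 a5 a6 a7 a8 a9 a10 a11
  obtain ⟨c, hc⟩ := a8.exists_eq_smul_one_add_J hL
  obtain ⟨q, hq⟩ := a9.exists_eq_smul_one_add_J hL
  obtain ⟨c', hc'⟩ := a10.exists_eq_smul_one_add_J hL
  obtain ⟨p, hp⟩ := a11.exists_eq_smul_one_add_J hL
  rw [hc, hc'] at a7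
  have b1 := a7.1.prim_eq hL (left_mem_Icc.2 hL.le)
  have b2 := a7.2.1.prim_eq hL (left_mem_Icc.2 hL.le)
  have b3 := a7.2.2.prim_eq hL (right_mem_Icc.2 hL.le)
  rw [prim_zero] at b1 b2
  rw [prim_right hL.le, b1, zero_add] at b3
  rw [b1, zero_smul, zero_add] at hc
  rw [b2, zero_smul, zero_add] at hc'
  rw [a1, a2, a3, a4, a5] at a6
  exact ⟨⟨hc, b3⟩, hc', ⟨q, hq⟩, ⟨p, hp⟩, a6⟩

/-- The regularity and the equations of a solution of the limit problem. The boundary value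
`b t = ψ(0, t)` is a Lipschitz path, and `u(0, t) = -U l b t`, `l = λ²`. -/
theorem limit_data (hL : 0 < L) (hT : 0 < T) {U lam : ℝ} {f g : ℝ → L2 L} {u₀ ψ₀ : L2 L}
    {u ψ : ℝ → L2 L} (hK : MemK0 U lam T u ψ) (hS : SolvesLimit U lam T f g u₀ ψ₀ u ψ) :
    ∃ (ut ψt ux uxx ψx ψxx ψxt : ℝ → L2 L) (d : L2 L) (b β : ℝ → ℝ) (b₀ : ℝ), IsPath T u ut u₀ ∧
      IsPath T ψ ψt ψ₀ ∧ IsPath T ψx ψxt d ∧ IsPath T b β b₀ ∧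
      MemLp ux ∞ (volume.restrict (Ioo 0 T)) ∧ MemLp uxx ∞ (volume.restrict (Ioo 0 T)) ∧
      ∀ᵐ t ∂(volume.restrict (Ioo 0 T)), (u t = (-(U * lam ^ 2 * b t)) • one L + J hL.le (ux t) ∧
        ⟪one L, ux t⟫ = U * lam ^ 2 * b t) ∧
        ψ t = b t • one L + J hL.le (ψx t) ∧ (∃ q : ℝ, ux t = q • one L + J hL.le (uxx t)) ∧
        (∃ p : ℝ, ψx t = p • one L + J hL.le (ψxx t)) ∧
        ut t + U • ux t + ψx t = f t ∧
        ψt t + U • ψx t + (lam⁻¹ ^ 2) • ux t = g t := by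
  obtain ⟨hu, hψ, ⟨-, -, ⟨vx, -, hvx, -, hvx', -⟩, hbc⟩, ⟨ux, uxx, hux, huxx, huxx'⟩,
    ⟨ψx, ψxt, ψxx, hψx, hψxt, hψxx, hψxt', -⟩, ut, ψt, hut, hψt, hut', hψt'⟩ := hK
  obtain ⟨⟨wt, φt, wx, φx, hwt, hφt, hwx, hφx, heq⟩, -, h0, h0'⟩ := hS
  obtain ⟨d, hd⟩ := HasWeakDeriv.exists_isPath hT hψxt hψxt'
  have hψp := hψt.isPath hT hψ hψt'
  -- `b` is the mean over `(0, L)` of the constant `ψ - J ψx`, hence as regular in time as these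
  have hb := ((hψp.sub (hd.map (J hL.le))).map (L⁻¹ • innerSL ℝ (one L)))
  refine ⟨ut, ψt, ux, uxx, ψx, ψxx, ψxt, d, _, _, _, h0 ▸ hut.isPath hT hu hut',
    h0' ▸ hψp, hd, hb, hvx'.ae_eq (hvx.ae_eq hux), huxx', ?_⟩
  filter_upwards [HasWeakDeriv.unique hwt hut, HasWeakDeriv.unique hφt hψt, hwx.ae_eq hux,
    hφx.ae_eq hψx, heq, hbc, hux, huxx, hψx, hψxx] with t a1 a2 a3 a4 a6 a7 a8 a9 a10 a11
  obtain ⟨c, hc⟩ := a8.exists_eq_smul_one_add_J hL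
  obtain ⟨q, hq⟩ := a9.exists_eq_smul_one_add_J hL
  obtain ⟨c', hc'⟩ := a10.exists_eq_smul_one_add_J hL
  obtain ⟨p, hp⟩ := a11.exists_eq_smul_one_add_J hL
  have hbt : (L⁻¹ • innerSL ℝ (one L)) (ψ t - J hL.le (ψx t)) = c' := by
    have : ψ t - J hL.le (ψx t) = c' • one L := by rw [hc']; abel
    rw [this]
    simp only [smul_apply, innerSL_apply_apply, real_inner_smul_right,
      inner_one_one hL.le, smul_eq_mul]
    field_simp
  rw [hbt]
  obtain ⟨⟨a, b, ha, hb, hab⟩, hr⟩ := a7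
  rw [hc] at ha hr
  rw [hc'] at hb
  have b1 := ha.prim_eq hL (left_mem_Icc.2 hL.le)
  have b2 := hb.prim_eq hL (left_mem_Icc.2 hL.le)
  have b3 := hr.prim_eq hL (right_mem_Icc.2 hL.le)
  rw [prim_zero] at b1 b2
  rw [prim_right hL.le] at b3
  have b4 : c = -(U * lam ^ 2 * c') := by rw [b1, b2]; linarith
  rw [a1, a2, a3, a4] at a6
  refine ⟨⟨by rw [← b4]; exact hc, by linarith⟩, hc', ⟨q, hq⟩, ⟨p, hp⟩, a6⟩

end Data

section Corrector

variable {L : ℝ}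

/-- The profile `(1 - x / L) exp (-a x)` of the boundary layer corrector. -/
def layer (L a x : ℝ) : ℝ := (1 - L⁻¹ * x) * expW a x

/-- The derivative of `layer`. -/
def layer' (L a x : ℝ) : ℝ := -a * layer L a x - L⁻¹ * expW a x

theorem hasDerivAt_layer (L a x : ℝ) : HasDerivAt (layer L a) (layer' L a x) x := by
  have h1 : HasDerivAt (fun x => 1 - L⁻¹ * x) (-L⁻¹) x := by
    simpa using ((hasDerivAt_id x).const_mul L⁻¹).const_sub 1
  refine (h1.mul (hasDerivAt_expW a x)).congr_deriv ?_
  rw [layer', layer]; ring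

theorem hasDerivAt_layer' (L a x : ℝ) :
    HasDerivAt (layer' L a) (-a * layer' L a x + a * L⁻¹ * expW a x) x := by
  refine (((hasDerivAt_layer L a x).const_mul (-a)).sub
    ((hasDerivAt_expW a x).const_mul L⁻¹)).congr_deriv ?_
  ring

theorem continuous_layer (L a : ℝ) : Continuous (layer L a) :=
  continuous_iff_continuousAt.2 fun x => (hasDerivAt_layer L a x).continuousAt

theorem continuous_layer' (L a : ℝ) : Continuous (layer' L a) :=
  continuous_iff_continuousAt.2 fun x => (hasDerivAt_layer' L a x).continuousAt

theorem abs_layer_le (hL : 0 < L) (a : ℝ) {x : ℝ} (hx : x ∈ Ioo 0 L) :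
    |layer L a x| ≤ expW a x := by
  have h1 : 0 ≤ 1 - L⁻¹ * x := by rw [sub_nonneg, inv_mul_le_one₀ hL]; exact hx.2.le
  have h2 : 1 - L⁻¹ * x ≤ 1 := by
    have := mul_nonneg (inv_nonneg.2 hL.le) hx.1.le
    linarith
  rw [layer, abs_mul, abs_of_nonneg h1, abs_of_pos (expW_pos a x)]
  exact mul_le_of_le_one_left (expW_pos a x).le h2

theorem abs_layer'_le (hL : 0 < L) {a : ℝ} (ha : 0 ≤ a) {x : ℝ} (hx : x ∈ Ioo 0 L) :
    |layer' L a x| ≤ a + L⁻¹ := by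
  have h1 := expW_le_one ha hx.1.le
  have h2 := (abs_layer_le hL a hx).trans h1
  rw [layer']
  refine (abs_sub _ _).trans ?_
  rw [abs_mul, abs_mul, abs_neg, abs_of_nonneg ha, abs_of_pos (expW_pos a x),
    abs_of_pos (inv_pos.2 hL)]
  have := inv_pos.2 hL
  exact add_le_add (mul_le_of_le_one_right ha h2) (mul_le_of_le_one_right this.le h1)

theorem inner_one_toL2_layer' (hL : 0 < L) (a : ℝ) : ⟪one L, toL2 L (layer' L a)⟫ = -1 := by
  rw [inner_one hL.le, intervalIntegral.integral_congr_ae ((ae_Ioo_iff_ae_uIoc hL.le).1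
    (coeFn_toL2_of_continuous (continuous_layer' L a))),
    intervalIntegral.integral_eq_sub_of_hasDerivAt (fun y _ => hasDerivAt_layer L a y)
      ((continuous_layer' L a).intervalIntegrable _ _)]
  simp [layer, expW, hL.ne']

theorem toL2_layer (hL : 0 < L) (a : ℝ) :
    toL2 L (layer L a) = one L + J hL.le (toL2 L (layer' L a)) := by
  have h := toL2_eq_smul_one_add_J hL.le (hasDerivAt_layer L a) (continuous_layer' L a)
  rwa [show layer L a 0 = 1 by simp [layer, expW], one_smul] at h

theorem toL2_layer' (hL : 0 < L) (a : ℝ) :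
    toL2 L (layer' L a) = layer' L a 0 • one L + J hL.le (-a • toL2 L (layer' L a)
      + (a * L⁻¹) • toL2 L (expW a)) := by
  have hc : Continuous fun x => -a * layer' L a x + a * L⁻¹ * expW a x :=
    ((continuous_layer' L a).const_mul _).add ((continuous_expW a).const_mul _)
  rw [toL2_eq_smul_one_add_J hL.le (hasDerivAt_layer' L a) hc]
  congr 2
  rw [← toL2_eq_smul_one_add_J hL.le (hasDerivAt_layer' L a) hc]
  apply Lp.ext
  filter_upwards [coeFn_toL2_of_continuous hc, coeFn_toL2_of_continuous (continuous_layer' L a),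
    coeFn_toL2_of_continuous (continuous_expW a),
    Lp.coeFn_add (-a • toL2 L (layer' L a)) ((a * L⁻¹) • toL2 L (expW a)),
    Lp.coeFn_smul (-a) (toL2 L (layer' L a)), Lp.coeFn_smul (a * L⁻¹) (toL2 L (expW a))]
    with x h1 h2 h3 h4 h5 h6
  rw [h1, h4, Pi.add_apply, h5, h6, Pi.smul_apply, Pi.smul_apply, h2, h3, smul_eq_mul, smul_eq_mul]

end Corrector

/-! ### The error outside the boundary layer -/

section Main

variable {L T : ℝ}

/-- Interpolation between a norm `O(ε)` of a function vanishing at `0` and a norm `O(ε ^ (-1/2))` of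
its derivative. -/
theorem abs_prim_le {C ε : ℝ} (hε : 0 < ε) {w : L2 L} {x : ℝ} (hx : x ∈ Icc 0 L)
    (h1 : ‖J (hx.1.trans hx.2) w‖ ≤ C * ε) (h2 : ‖w‖ ^ 2 ≤ C / ε) :
    |prim 0 w x| ≤ √√(4 * C ^ 3 * ε) := by
  have h3 := sq_prim_le 0 w hx
  simp only [zero_smul, zero_add, ne_eq, OfNat.ofNat_ne_zero, not_false_eq_true, zero_pow] at h3
  refine Real.le_sqrt_of_sq_le (Real.le_sqrt_of_sq_le ?_)
  rw [sq_abs]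
  calc (prim 0 w x ^ 2) ^ 2 ≤ (2 * (‖J (hx.1.trans hx.2) w‖ * ‖w‖)) ^ 2 := by gcongr
    _ = 4 * (‖J (hx.1.trans hx.2) w‖ ^ 2 * ‖w‖ ^ 2) := by ring
    _ ≤ 4 * ((C * ε) ^ 2 * (C / ε)) := by gcongr
    _ = 4 * C ^ 3 * ε := by field_simp

set_option maxHeartbeats 800000 in
/-- The error of the approximation by the limit solution is, uniformly in time, the sum of a
vanishing term and of a boundary layer of width `ε`. -/
theorem exists_layer_bound (hL : 0 < L) (hT : 0 < T) {U lam ε₀ : ℝ} (hU : 0 < U) (hlam : 0 < lam)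
    (hUlam : U < lam⁻¹) {f g : ℝ → L2 L} {u₀ ψ₀ : L2 L} {uε ψε : ℝ → ℝ → L2 L} {u ψ : ℝ → L2 L}
    (hKε : ∀ ε ∈ Ioo 0 ε₀, MemK T (uε ε) (ψε ε))
    (hSε : ∀ ε ∈ Ioo 0 ε₀, SolvesViscous U lam T ε f g u₀ ψ₀ (uε ε) (ψε ε))
    (hK : MemK0 U lam T u ψ) (hS : SolvesLimit U lam T f g u₀ ψ₀ u ψ) :
    ∃ C α : ℝ, 0 ≤ C ∧ 0 < α ∧ ∀ ε ∈ Ioo 0 ε₀, ε ≤ 1 → ∀ᵐ t ∂(volume.restrict (Ioo 0 T)),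
      ∀ᵐ x ∂(volume.restrict (Ioo 0 L)),
        |(uε ε t - u t : L2 L) x| ≤ √√(C * ε) + C * expW (α / ε) x ∧
        |(ψε ε t - ψ t : L2 L) x| ≤ √√(C * ε) + C * expW (α / ε) x := by
  obtain ⟨ut, ψt, ux, uxx, ψx, ψxx, ψxt, d, b, β, b₀, hut, hψt, hψx, hb, hux, huxx, hlim⟩ :=
    limit_data hL hT hK hS
  set l := lam ^ 2 with hl
  have hl0 : 0 < l := by positivity
  have hinv : lam⁻¹ ^ 2 = l⁻¹ := by rw [hl, inv_pow]
  -- the ratio of the components of the corrector `b (A k, -k)`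
  set A := U * l with hA
  have hA0 : 0 < A := by positivity
  have hUl : U ^ 2 < l⁻¹ := by rw [← hinv]; gcongr
  -- the decay rate of the stationary boundary layer
  set α := (l⁻¹ - U ^ 2) / (2 * U) with hα
  have hα0 : 0 < α := div_pos (sub_pos.2 hUl) (by positivity)
  have hAα : 2 * A * α = 1 - A * U := by rw [hA, hα]; field_simp
  have hAl : l⁻¹ * A = U := by rw [hA]; field_simp
  have hK1 : l * U * α ≤ 1 := by
    have : 0 < A * U := by positivity
    have h2 : l * U * α = A * α := by rw [hA]; ring
    rw [h2]; linarith
  obtain ⟨M₁, hM₁, hβM⟩ := exists_bound_of_memLp_top hb.1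
  obtain ⟨M₂, hM₂, hbM⟩ := exists_bound_of_memLp_top hb.memLp_top
  obtain ⟨M₃, hM₃, huM⟩ := exists_bound_of_memLp_top huxx
  set Z := |(1 - A * U) * L⁻¹| with hZ
  set M := M₁ + A * M₁ + Z * M₂ + 2 * M₃ + 1 with hM
  have hZ0 : 0 ≤ Z := abs_nonneg _
  have hM0 : 0 < M := by positivity
  set ν : ℝ := (measureUnivNNReal (volume.restrict (Ioo (0 : ℝ) L)) : ℝ) ^ (2 : ℝ≥0∞).toReal⁻¹
    with hν
  obtain ⟨C, hC0, hmain⟩ := IsErrorSystem.deriv_bound hL hT hl0 hU hα0 hM0 hK1 (ν * (α + L⁻¹))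
  refine ⟨4 * C ^ 3 + A * M₂ + M₂, α, by positivity, hα0, fun ε hε hε1 => ?_⟩
  have hε0 : 0 < ε := hε.1
  obtain ⟨vt, φt, vx, vxx, φx, φxx, φxt, d', hvt, hφt, hφx, hvx, hvxx, hvis⟩ :=
    viscous_data hL hT (hKε ε hε) (hSε ε hε)
  set a := α / ε with ha
  have ha0 : 0 < a := by positivity
  have hAa : 2 * ε * A * a = 1 - A * U := by rw [← hAα, ha]; field_simp
  set k := toL2 L (layer L a) with hk
  set k' := toL2 L (layer' L a) with hk'
  set e := toL2 L (expW a) with he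
  set k'' := -a • k' + (a * L⁻¹) • e with hk''
  have hk1 : k = one L + J hL.le k' := toL2_layer hL a
  have hk2 : k' = layer' L a 0 • one L + J hL.le k'' := toL2_layer' hL a
  have hk3 : ⟪one L, k'⟫ = -1 := inner_one_toL2_layer' hL a
  have hkn : ‖k'‖ ≤ ν * (α + L⁻¹) / ε := by
    have h1 : ‖k'‖ ≤ ν * (a + L⁻¹) := norm_le_of_ae_abs_le (by positivity) (by
      filter_upwards [coeFn_toL2_of_continuous (continuous_layer' L a),
        ae_restrict_mem measurableSet_Ioo] with x hx hx'
      rw [hx]; exact abs_layer'_le hL ha0.le hx')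
    refine h1.trans ?_
    rw [mul_div_assoc, add_div]
    have h2 : L⁻¹ ≤ L⁻¹ / ε := by
      rw [le_div_iff₀ hε0]; exact mul_le_of_le_one_right (by positivity) hε1
    gcongr
  -- `ψ^ε - ψ⁰ + b` is the primitive of `ψ^ε_x - ψ⁰_x` at almost all times, hence also for the
  -- initial values of the paths, where `ψ^ε - ψ⁰` is `0`; so `b` and `ψ^ε_x - ψ⁰_x` start at `0`
  have hzero : IsPath T (fun t => (ψε ε t - ψ t) - J hL.le (φx t - ψx t) + b t • one L)
      (fun t => (φt t - ψt t) - J hL.le (φxt t - ψxt t) + β t • one L)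
      ((ψ₀ - ψ₀) - J hL.le (d' - d) + b₀ • one L) := by
    simpa using ((hφt.sub hψt).sub ((hφx.sub hψx).map (J hL.le))).add
      (hb.map (ContinuousLinearMap.toSpanSingleton ℝ (one L)))
  obtain ⟨hz0, hzt⟩ := hzero.eq_zero hT (by
    filter_upwards [hlim, hvis] with t h1 h2
    rw [h1.2.1, h2.2.1, map_sub, Pi.zero_apply]
    abel)
  have hinit : b₀ = 0 ∧ d' - d = 0 := by
    have h1 : b₀ • one L + J hL.le (-(d' - d)) = 0 := by
      rw [← hz0, map_neg]; abel
    obtain ⟨h2, h3⟩ := eq_zero_of_smul_one_add_J_eq_zero hL h1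
    exact ⟨h2, neg_eq_zero.1 h3⟩
  have hbk : ∀ v : L2 L, IsPath T (fun t => b t • v) (fun t => β t • v) 0 := fun v => by
    simpa [hinit.1] using hb.map (ContinuousLinearMap.toSpanSingleton ℝ v)
  have hbv : ∀ v : L2 L, MemLp (fun t => b t • v) ∞ (volume.restrict (Ioo 0 T)) := fun v =>
    (hbk v).memLp_top
  -- `st` is the primitive of `sxt`, which allows differentiating the equation for `s` in space
  have hder : ∀ᵐ t ∂(volume.restrict (Ioo 0 T)),
      φt t - ψt t + β t • k = J hL.le (φxt t - ψxt t + β t • k') := by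
    filter_upwards [hzt] with t ht
    rw [Pi.zero_apply] at ht
    rw [hk1, map_add, map_smul, smul_add]
    linear_combination (norm := module) ht
  have hsx : ∀ᵐ t ∂(volume.restrict (Ioo 0 T)), ∃ p q : ℝ,
      (vx t - ux t - b t • A • k' = q • one L + J hL.le (vxx t - uxx t - b t • A • k'') ∧
      φx t - ψx t + b t • k' = p • one L + J hL.le (φxx t - ψxx t + b t • k'') ∧
      U * p + l⁻¹ * q = β t) ∧
      φxt t - ψxt t + β t • k' = β t • k' - U • (φxx t - ψxx t + b t • k'')
        - l⁻¹ • (vxx t - uxx t - b t • A • k'') := by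
    filter_upwards [hlim, hvis, hder] with t h1 h2 h3
    obtain ⟨-, -, ⟨q₀, hq₀⟩, ⟨p₀, hp₀⟩, -, h4⟩ := h1
    obtain ⟨-, -, ⟨q₁, hq₁⟩, ⟨p₁, hp₁⟩, -, h5⟩ := h2
    set q := q₁ - q₀ - b t * A * layer' L a 0 with hq
    set p := p₁ - p₀ + b t * layer' L a 0 with hp
    have e1 : vx t - ux t - b t • A • k' = q • one L + J hL.le (vxx t - uxx t - b t • A • k'') := by
      simp only [map_sub, map_smul]
      rw [hq, hq₀, hq₁]
      nth_rewrite 1 [hk2]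
      module
    have e2 : φx t - ψx t + b t • k' = p • one L + J hL.le (φxx t - ψxx t + b t • k'') := by
      simp only [map_sub, map_add, map_smul]
      rw [hp, hp₀, hp₁]
      nth_rewrite 1 [hk2]
      module
    have e3 : φt t - ψt t + U • (φx t - ψx t) + l⁻¹ • (vx t - ux t) = 0 := by
      rw [← hinv]
      have h6 := h5.trans h4.symm
      linear_combination (norm := module) h6
    -- the equation for `s`, in which every term is a primitive
    have e4 : (U * p + l⁻¹ * q - β t) • one L + J hL.le ((φxt t - ψxt t)
        + U • (φxx t - ψxx t + b t • k'') + l⁻¹ • (vxx t - uxx t - b t • A • k'')) = 0 := by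
      have e5 : (U * p + l⁻¹ * q - β t) • one L + J hL.le ((φxt t - ψxt t)
          + U • (φxx t - ψxx t + b t • k'') + l⁻¹ • (vxx t - uxx t - b t • A • k''))
          = J hL.le (φxt t - ψxt t + β t • k') - β t • k
            + U • (φx t - ψx t + b t • k') + l⁻¹ • (vx t - ux t - b t • A • k') := by
        rw [e1, e2, hk1]
        simp only [map_add, map_smul]
        module
      rw [e5, ← h3]
      have e6 : l⁻¹ • b t • A • k' = U • b t • k' := by
        rw [← hAl]; module
      rw [smul_sub, e6]
      linear_combination (norm := module) e3
    obtain ⟨e7, e8⟩ := eq_zero_of_smul_one_add_J_eq_zero hL e4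
    refine ⟨p, q, ⟨e1, e2, by linarith⟩, ?_⟩
    linear_combination (norm := module) e8
  -- the remaining forcing is `2 ε u⁰_xx`, the time derivative of the corrector, and the effect of
  -- the cutoff `1 - x / L` in the viscous term
  have hsys : IsErrorSystem hL T U l α M ε k k' e β (fun t => -(A * β t))
      (fun t => (1 - A * U) * L⁻¹ * b t)
      (fun t => uε ε t - u t - b t • A • k) (fun t => vx t - ux t - b t • A • k')
      (fun t => vxx t - uxx t - b t • A • k'') (fun t => vt t - ut t - β t • A • k)
      (fun t => ψε ε t - ψ t + b t • k) (fun t => φx t - ψx t + b t • k')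
      (fun t => φxx t - ψxx t + b t • k'') (fun t => φt t - ψt t + β t • k)
      (fun t => φxt t - ψxt t + β t • k') (fun t => (2 : ℝ) • uxx t) :=
    { path_r := by simpa using (hvt.sub hut).sub (hbk (A • k))
      path_s := by simpa using (hφt.sub hψt).add (hbk k)
      path_sx := by simpa [hinit.2] using (hφx.sub hψx).add (hbk k')
      memLp_rx := (hvx.sub hux).sub (hbv (A • k'))
      memLp_rxx := (hvxx.sub huxx).sub (hbv (A • k''))
      abs_k_le := by
        filter_upwards [coeFn_toL2_of_continuous (continuous_layer L a),
          ae_restrict_mem measurableSet_Ioo] with x hx hx'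
        rw [hx]; exact abs_layer_le hL a hx'
      abs_e_le := by
        filter_upwards [coeFn_toL2_of_continuous (continuous_expW a)] with x hx
        rw [hx, abs_of_pos (expW_pos a x)]
      bounds := by
        filter_upwards [hβM, hbM, huM] with t h1 h2 h3
        rw [Real.norm_eq_abs] at h1 h2
        have p1 : 0 ≤ A * M₁ := by positivity
        have p2 : 0 ≤ Z * M₂ := by positivity
        refine ⟨?_, ?_, ?_, ?_⟩
        · rw [norm_smul, Real.norm_of_nonneg zero_le_two]; linarith
        · rw [abs_neg, abs_mul, abs_of_pos hA0]
          have := mul_le_mul_of_nonneg_left h1 hA0.le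
          linarith
        · rw [abs_mul, ← hZ]
          have := mul_le_mul_of_nonneg_left h2 hZ0
          linarith
        · linarith
      space_r := by
        filter_upwards [hlim, hvis] with t h1 h2
        refine ⟨?_, ?_⟩
        · rw [h1.1.1, h2.1.1, hk1]
          simp only [map_sub, map_smul]
          module
        · rw [inner_sub_right, inner_sub_right, h2.1.2, h1.1.2, real_inner_smul_right,
            real_inner_smul_right, hk3]
          ring
      space_s := by
        filter_upwards [hlim, hvis] with t h1 h2
        rw [h1.2.1, h2.2.1, hk1]
        simp only [map_sub, map_add, map_smul]
        module
      space_x := by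
        filter_upwards [hsx] with t ht
        obtain ⟨p, q, h1, -⟩ := ht
        exact ⟨p, q, h1⟩
      eq_r := by
        filter_upwards [hlim, hvis] with t h1 h2
        have h6 := h2.2.2.2.2.1.trans h1.2.2.2.2.1.symm
        have h7 : (1 - A * U) • b t • k' = (2 * ε * A * a) • b t • k' := by rw [hAa]
        have h8 : ((1 - A * U) * L⁻¹ * b t) • e = (2 * ε * A * a * L⁻¹ * b t) • e := by rw [hAa]
        rw [h8, hk'']
        linear_combination (norm := module) h6 + h7
      eq_s := by
        filter_upwards [hlim, hvis] with t h1 h2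
        have h6 := h2.2.2.2.2.2.trans h1.2.2.2.2.2.symm
        rw [hinv] at h6
        have h7 : l⁻¹ • b t • A • k' = U • b t • k' := by
          rw [← hAl]; module
        rw [smul_sub l⁻¹, h7]
        linear_combination (norm := module) h6
      eq_sx := by
        filter_upwards [hsx] with t ht
        obtain ⟨p, q, -, h1⟩ := ht
        exact h1 }
  have hfin := hmain ε k k' e β _ _ _ _ _ _ _ _ _ _ _ _ hε0 hε1 hkn hsys
  filter_upwards [hfin, hsys.space_r, hsys.space_s, hbM] with t h1 h2 h3 h4
  rw [Real.norm_eq_abs] at h4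
  set rx := vx t - ux t - b t • A • k'
  set sx := φx t - ψx t + b t • k'
  have hrep : uε ε t - u t = (b t * A) • k + J hL.le rx := by
    rw [← h2.1, mul_smul]; abel
  have hrep' : ψε ε t - ψ t = (-b t) • k + J hL.le sx := by
    rw [← h3]; module
  rw [h2.1] at h1
  rw [h3] at h1
  rw [hrep, hrep']
  filter_upwards [Lp.coeFn_add ((b t * A) • k) (J hL.le rx), Lp.coeFn_smul (b t * A) k,
    Lp.coeFn_add ((-b t) • k) (J hL.le sx), Lp.coeFn_smul (-b t) k, coeFn_J hL.le rx,
    coeFn_J hL.le sx, hsys.abs_k_le, ae_restrict_mem measurableSet_Ioo]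
    with x a1 a2 a3 a4 a5 a6 a7 hx
  have hx' := Ioo_subset_Icc_self hx
  have b1 := abs_prim_le hε0 hx' h1.1 h1.2.2.1
  have b2 := abs_prim_le hε0 hx' h1.2.1 h1.2.2.2
  have b3 : √√(4 * C ^ 3 * ε) ≤ √√((4 * C ^ 3 + A * M₂ + M₂) * ε) := by
    gcongr
    have : 0 ≤ A * M₂ := by positivity
    linarith
  have hexp := expW_pos (α / ε) x
  have b4 : |b t| * |k x| ≤ M₂ * expW (α / ε) x := by gcongr
  have b5 : A * M₂ * expW (α / ε) x ≤ (4 * C ^ 3 + A * M₂ + M₂) * expW (α / ε) x := by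
    gcongr
    have : 0 ≤ 4 * C ^ 3 := by positivity
    linarith
  have b6 : M₂ * expW (α / ε) x ≤ (4 * C ^ 3 + A * M₂ + M₂) * expW (α / ε) x := by
    gcongr
    have : 0 ≤ 4 * C ^ 3 := by positivity
    have : 0 ≤ A * M₂ := by positivity
    linarith
  rw [a1, a3, Pi.add_apply, Pi.add_apply, a2, a4, Pi.smul_apply, Pi.smul_apply, a5, a6, smul_eq_mul,
    smul_eq_mul]
  have b7 : |b t * A| * |k x| ≤ A * M₂ * expW (α / ε) x := by
    rw [abs_mul, abs_of_pos hA0, mul_right_comm, mul_comm A, mul_right_comm]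
    gcongr
  have b8 : |-b t| * |k x| ≤ M₂ * expW (α / ε) x := by rwa [abs_neg]
  constructor
  · refine (abs_add_le _ _).trans ?_
    rw [abs_mul, add_comm]
    exact add_le_add (b1.trans b3) (b7.trans b5)
  · refine (abs_add_le _ _).trans ?_
    rw [abs_mul, add_comm]
    exact add_le_add (b2.trans b3) (b8.trans b6)

end Main

/-! ### The uniform norm near and away from the boundary -/

section Conclusion

variable {L T : ℝ}

theorem linfNorm_le {a b B : ℝ} {v w : ℝ → L2 L} (h : ∀ᵐ t ∂(volume.restrict (Ioo 0 T)),
    ∀ᵐ x ∂(volume.restrict (Ioo 0 L)), x ∈ Ioo a b → |(v t) x| ≤ B ∧ |(w t) x| ≤ B) :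
    linfNorm T a b v w ≤ ENNReal.ofReal B := by
  refine essSup_le_of_ae_le _ ?_
  filter_upwards [h] with t ht
  rw [eLpNorm_exponent_top]
  refine eLpNormEssSup_le_of_ae_bound ?_
  rw [ae_restrict_iff' measurableSet_Ioo]
  filter_upwards [ht] with x hx hxa
  exact max_le (hx hxa).1 (hx hxa).2

/-- The essential supremum near the left end controls the continuous representative at `0`. -/
theorem le_linfNorm (hL : 0 < L) {a m : ℝ} (ha : 0 < a) {v w w' : ℝ → L2 L} {c : ℝ → ℝ}
    (hw : ∀ᵐ t ∂(volume.restrict (Ioo 0 T)), w t = c t • one L + J hL.le (w' t))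
    (hm : ¬ ∀ᵐ t ∂(volume.restrict (Ioo 0 T)), |c t| < m) :
    ENNReal.ofReal m ≤ linfNorm T 0 a v w := by
  by_contra! hlt
  refine hm ?_
  filter_upwards [ae_lt_of_essSup_lt hlt, hw] with t h1 h2
  set N := eLpNorm (fun x => ((v t : ℝ → ℝ) x, (w t : ℝ → ℝ) x)) (∞ : ℝ≥0∞)
    ((volume.restrict (Ioo 0 L)).restrict (Ioo 0 a)) with hN
  have hNtop : N ≠ ⊤ := (h1.trans_le le_top).ne
  refine lt_of_le_of_lt ?_ ((ENNReal.lt_ofReal_iff_toReal_lt hNtop).1 h1)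
  have h3 : ∀ᵐ x ∂(volume.restrict (Ioo 0 (min a L))), |prim (c t) (w' t) x| ≤ N.toReal := by
    have h4 : (volume.restrict (Ioo 0 L)).restrict (Ioo 0 a)
        = volume.restrict (Ioo 0 (min a L)) := by
      rw [Measure.restrict_restrict measurableSet_Ioo, Ioo_inter_Ioo, max_self]
    rw [← h4]
    have h5 := ae_le_eLpNormEssSup (μ := (volume.restrict (Ioo 0 L)).restrict (Ioo 0 a))
      (f := fun x => ((v t : ℝ → ℝ) x, (w t : ℝ → ℝ) x))
    rw [← eLpNorm_exponent_top, ← hN] at h5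
    filter_upwards [h5, ae_restrict_of_ae (coeFn_smul_one_add_J hL.le (c t) (w' t))] with x h6 h7
    rw [← h2] at h7
    rw [← h7]
    refine (le_max_right |(v t) x| _).trans ?_
    simpa using ENNReal.toReal_mono hNtop h6
  have hmin : 0 < min a L := lt_min ha hL
  -- a null set has points of its complement arbitrarily close to `0`
  have hfreq : ∃ᶠ x in 𝓝[>] (0 : ℝ), |prim (c t) (w' t) x| ≤ N.toReal := by
    rw [frequently_nhdsWithin_iff, Metric.nhds_basis_ball.frequently_iff]
    intro r hr
    by_contra! hcon
    have hpos : 0 < min r (min a L) := lt_min hr hmin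
    have h8 : volume.restrict (Ioo 0 (min a L)) (Ioo 0 (min r (min a L))) = 0 := by
      refine measure_mono_null ?_ h3
      intro x hx hle
      refine hcon x ?_ hle hx.1
      rw [Metric.mem_ball, Real.dist_eq, sub_zero, abs_of_pos hx.1]
      exact hx.2.trans_le (min_le_left _ _)
    rw [Measure.restrict_apply measurableSet_Ioo, Ioo_inter_Ioo, max_self, Real.volume_Ioo,
      min_eq_left (min_le_right _ _), sub_zero, ENNReal.ofReal_eq_zero] at h8
    exact absurd h8 hpos.not_ge
  have hcont : Tendsto (fun x => |prim (c t) (w' t) x|) (𝓝[>] 0) (𝓝 |c t|) := by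
    have h9 := (prim_continuousOn hL.le (c t) (w' t)) 0 (left_mem_Icc.2 hL.le)
    rw [ContinuousWithinAt, prim_zero] at h9
    refine (h9.mono_left ?_).abs
    rw [← nhdsWithin_Ioc_eq_nhdsGT hL]
    exact nhdsWithin_mono _ Ioc_subset_Icc_self
  exact le_of_tendsto_of_frequently hcont hfreq

end Conclusion

end OceanBL

end

theorem corollary1p2 (U₀ lam L T ε₀ : ℝ) (hU : 0 < U₀) (hlam : 0 < lam) (hUlam : U₀ < lam⁻¹)
    (hL : 0 < L) (hT : 0 < T) (hε₀ : 0 < ε₀)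
    (f g : ℝ → OceanBL.L2 L) (u₀ ψ₀ : OceanBL.L2 L)
    (uε ψε : ℝ → ℝ → OceanBL.L2 L) (u ψ : ℝ → OceanBL.L2 L)
    (hKε : ∀ ε ∈ Ioo 0 ε₀, OceanBL.MemK T (uε ε) (ψε ε))
    (hsolε : ∀ ε ∈ Ioo 0 ε₀, OceanBL.SolvesViscous U₀ lam T ε f g u₀ ψ₀ (uε ε) (ψε ε))
    (hK : OceanBL.MemK0 U₀ lam T u ψ)
    (hsol : OceanBL.SolvesLimit U₀ lam T f g u₀ ψ₀ u ψ) :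
    (∀ δ : ℝ → ℝ, (∀ ε, 0 < ε → 0 ≤ δ ε) →
      Tendsto δ (𝓝[>] 0) (𝓝 0) → Tendsto (fun ε => δ ε / ε) (𝓝[>] 0) atTop →
      Tendsto (fun ε => OceanBL.linfNorm T (δ ε) L (uε ε - u) (ψε ε - ψ)) (𝓝[>] 0) (𝓝 0)) ∧
    (¬ OceanBL.VanishesAtLeft T u ψ →
      ∀ (δ : ℝ → ℝ) (c : ℝ), (∀ ε, 0 < ε → 0 ≤ δ ε) → (∀ᶠ ε in 𝓝[>] 0, 0 < δ ε) → 0 ≤ c →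
        Tendsto δ (𝓝[>] 0) (𝓝 0) → Tendsto (fun ε => δ ε / ε) (𝓝[>] 0) (𝓝 c) →
        0 < liminf (fun ε => OceanBL.linfNorm T 0 (δ ε) (uε ε - u) (ψε ε - ψ)) (𝓝[>] 0)) := by
  have hε : ∀ᶠ ε : ℝ in 𝓝[>] 0, ε ∈ Ioo 0 (min ε₀ 1) :=
    Ioo_mem_nhdsGT (lt_min hε₀ one_pos)
  constructor
  · intro δ _ _ hδ
    obtain ⟨C, α, hC, hα, hmain⟩ :=
      OceanBL.exists_layer_bound hL hT hU hlam hUlam hKε hsolε hK hsol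
    have hlim : Tendsto (fun ε => ENNReal.ofReal (√√(C * ε) + C * Real.exp (-(α * (δ ε / ε)))))
        (𝓝[>] 0) (𝓝 0) := by
      rw [← ENNReal.ofReal_zero]
      refine ENNReal.tendsto_ofReal ?_
      have h1 : Tendsto (fun ε : ℝ => √√(C * ε)) (𝓝[>] 0) (𝓝 0) := by
        have : Continuous fun ε : ℝ => √√(C * ε) := by fun_prop
        simpa using (this.tendsto 0).mono_left nhdsWithin_le_nhds
      have h2 : Tendsto (fun ε => C * Real.exp (-(α * (δ ε / ε)))) (𝓝[>] 0) (𝓝 0) := by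
        simpa using (Real.tendsto_exp_neg_atTop_nhds_zero.comp
          (hδ.const_mul_atTop hα)).const_mul C
      simpa using h1.add h2
    refine tendsto_of_tendsto_of_tendsto_of_le_of_le' tendsto_const_nhds hlim
      (Eventually.of_forall fun _ => zero_le) ?_
    filter_upwards [hε] with ε h1
    refine OceanBL.linfNorm_le ?_
    filter_upwards [hmain ε ⟨h1.1, h1.2.trans_le (min_le_left _ _)⟩
      (h1.2.le.trans (min_le_right _ _))] with t h2
    filter_upwards [h2] with x h3 hx
    have h4 : C * OceanBL.expW (α / ε) x ≤ C * Real.exp (-(α * (δ ε / ε))) := by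
      refine mul_le_mul_of_nonneg_left (Real.exp_le_exp.2 (neg_le_neg ?_)) hC
      rw [← mul_div_assoc, mul_div_right_comm]
      exact mul_le_mul_of_nonneg_left hx.1.le (div_nonneg hα.le h1.1.le)
    exact ⟨h3.1.trans (by gcongr), h3.2.trans (by gcongr)⟩
  · intro hne δ _ _ hδ _ _ _
    obtain ⟨_, _, ux, _, ψx, _, _, _, b, _, _, -, -, -, -, -, -, hlim⟩ :=
      OceanBL.limit_data hL hT hK hsol
    -- `ψ^ε - ψ⁰` takes the value `-b t` at `x = 0`, whatever the size of `δ ε > 0`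
    obtain ⟨m, hm, hbm⟩ : ∃ m > 0, ¬ ∀ᵐ t ∂(volume.restrict (Ioo 0 T)), |-b t| < m := by
      by_contra! hcon
      refine hne ?_
      have hall : ∀ᵐ t ∂(volume.restrict (Ioo 0 T)), ∀ n : ℕ, |-b t| < 1 / ((n : ℝ) + 1) :=
        ae_all_iff.2 fun n => hcon _ Nat.one_div_pos_of_nat
      filter_upwards [hall, hlim] with t h1 h2
      have hb : b t = 0 := by
        by_contra hb
        obtain ⟨n, hn⟩ := exists_nat_one_div_lt (abs_pos.2 (neg_ne_zero.2 hb))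
        exact absurd (h1 n) hn.not_gt
      obtain ⟨⟨h3, -⟩, h4, -⟩ := h2
      rw [h3, h4, hb, mul_zero, neg_zero]
      exact ⟨OceanBL.hasValueAt_zero hL _ _, OceanBL.hasValueAt_zero hL _ _⟩
    refine (ENNReal.ofReal_pos.2 hm).trans_le (le_liminf_of_le (by isBoundedDefault) ?_)
    filter_upwards [hε, hδ] with ε h1 h2
    have hε' : ε ∈ Ioo 0 ε₀ := ⟨h1.1, h1.2.trans_le (min_le_left _ _)⟩
    obtain ⟨_, _, _, _, φx, _, _, _, -, -, -, -, -, hvis⟩ :=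
      OceanBL.viscous_data hL hT (hKε ε hε') (hsolε ε hε')
    refine OceanBL.le_linfNorm hL h2 (c := fun t => -b t) (w' := fun t => φx t - ψx t) ?_ hbm
    filter_upwards [hlim, hvis] with t h3 h4
    rw [Pi.sub_apply, h3.2.1, h4.2.1, map_sub]
    module
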